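/- Let $n\ge 2$ and let $C\subset\mathbb R^n$ be an $n$-dimensional pointed polyhedral cone with apex at the origin. Then $C$ has a non-redundant representation $C=\{x:\langle a_i,x\rangle\le 0,\ 1\le i\le m\}$ with unit vectors $a_i$. Fix such a representation. For a face $F$ of $C$ of dimension $\dim F\le n-1$ put $I_F=\{i:\langle a_i,x\rangle=0\ \forall x\in F\}$, $u_F=\sum_{i\in I_F}a_i/\|\sum_{i\in I_F}a_i\|$ and $p_F(x)=-\langle u_F,x\rangle$. For $0<\varepsilon\le 1/2$ and a natural number $q$ define $p_{C_F,\varepsilon}$ as follows. If $\dim F\ge n-2$, then $p_{C_F,\varepsilon}=p_F$. If $\dim F\le n-3$, let $\tilde a_i$ ($i\in I_F$) be the orthogonal projection of $a_i$ onto $u_F^\perp$ divided by its length $\ell_i$, let $\tilde b_i=\langle a_i,u_F\rangle/\ell_i$, $\gamma=\max_{i\in I_F}(1-\langle a_i,u_F\rangle^2)^{-1/2}$, let $\mu$ be given by $\mu/(\mu+\gamma)=\varepsilon$, let $$P_\mu=\{y\in \mathrm{lin}(F)^\perp\cap u_F^\perp:\ \langle\tilde a_i,y\rangle\le\tilde b_i+\mu,\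 i\in I_F\},$$ let $h$ be the support function of the polytope $P_\mu$, $h_i^\pm=h(\pm\tilde a_i)$, and $$p_{C_F,\varepsilon}(x)=p_F(x)^{2q}-\frac1{|I_F|}\sum_{i\in I_F}\left(\frac{2\langle\tilde a_i,x\rangle-(h_i^+-h_i^-)\,p_F(x)}{h_i^++h_i^-}\right)^{2q}.$$ Call $q$ admissible for $(F,\varepsilon)$ if $q>\ln|I_F|\,/\,\bigl(2\ln(1+\tfrac{2\mu}{(n-\dim F)\,\mathrm{diam}(P_\mu)})\bigr)$. Then there is a constant $c\in(0,1/2]$, depending only on $C$, such that the following holds for all numbers $\varepsilon_k$ with $0<\varepsilon_k\le c$ for $0\le k\le n-3$ and $\varepsilon_k\le c\,\varepsilon_l$ for $0\le k<l\le n-3$ ($\varepsilon_{n-2},\varepsilon_{n-1}\in(0,1/2]$ are arbitrary and play no role), and every choice, for each face $F$ of dimension $k\le n-3$, of an exponent $q$ admissible for $(F,\varepsilon_k)$. For $0\le k\le n-1$ let $$\mathfrak P_{k,1}=\prod_{F\ k\text{-face of }C}p_F,\qquad \mathfrak P_{k,2}=\prod_{F\ k\text{-face of }C}p_{C_F,\varepsilon_k}.$$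 Then $\mathfrak P_{n-1,1}=\mathfrak P_{n-1,2}$, $\mathfrak P_{n-2,1}=\mathfrak P_{n-2,2}$, and $C$ is described by the remaining $2n-2$ polynomials: $$C=\{x\in\mathbb R^n:\ \mathfrak P_{k,1}(x)\ge0\ (0\le k\le n-1),\ \ \mathfrak P_{k,2}(x)\ge0\ (0\le k\le n-3)\}.$$ -/

import Mathlib

open scoped InnerProductSpace

noncomputable section

namespace ConePoly

/-- `ℝⁿ` with the standard inner product and the Euclidean norm. -/
abbrev Rn (n : ℕ) := EuclideanSpace ℝ (Fin n)

variable {n : ℕ}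

/-- The intersection `{x : ⟪a, x⟫ ≤ 0 for all a ∈ A}` of finitely many closed halfspaces. -/
def coneOf (A : Finset (Rn n)) : Set (Rn n) := {x | ∀ a ∈ A, ⟪a, x⟫_ℝ ≤ 0}

/-- Polyhedral cones with apex at the origin. -/
def IsPolyhedralCone (C : Set (Rn n)) : Prop := ∃ A : Finset (Rn n), C = coneOf A

/-- A cone is pointed if it contains no line through the origin. -/
def IsPointed (C : Set (Rn n)) : Prop := ∀ x ∈ C, -x ∈ C → x = 0

/-- The dimension of a set that contains the origin (a cone or a face of a cone): the dimension
of its linear hull. -/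
def coneDim (F : Set (Rn n)) : ℕ := Module.finrank ℝ (Submodule.span ℝ F)

/-- `C = {x : ⟪a, x⟫ ≤ 0 for all a ∈ A}` is a non-redundant representation of `C` by unit
vectors: no inequality can be dropped. -/
structure IsNonredundantRep (A : Finset (Rn n)) (C : Set (Rn n)) : Prop where
  norm_eq_one : ∀ a ∈ A, ‖a‖ = 1
  eq_coneOf : C = coneOf A
  nonredundant : ∀ B : Finset (Rn n), B ⊂ A → coneOf B ≠ C

/-- The set of `k`-dimensional faces of `C`. (Faces of a polyhedron are its non-empty exposed
subsets; there are finitely many of them.) -/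
def faces (C : Set (Rn n)) (k : ℕ) : Set (Set (Rn n)) :=
  {F | F.Nonempty ∧ IsExposed ℝ C F ∧ coneDim F = k}

open Classical in
/-- The normal vectors of the constraints that are active on `F`. -/
def active (A : Finset (Rn n)) (F : Set (Rn n)) : Finset (Rn n) :=
  A.filter fun a => ∀ x ∈ F, ⟪a, x⟫_ℝ = 0

/-- The outer unit normal vector `u_F = (∑ a) / ‖∑ a‖` (sums over the active constraints). -/
def outerNormal (A : Finset (Rn n)) (F : Set (Rn n)) : Rn n :=
  ‖∑ a ∈ active A F, a‖⁻¹ • ∑ a ∈ active A F, a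

/-- The linear form `x ↦ ⟪v, x⟫` as a polynomial. -/
def linForm (v : Rn n) : MvPolynomial (Fin n) ℝ :=
  ∑ i, MvPolynomial.C (v i) * MvPolynomial.X i

/-- `p_F(x) = ⟪-u_F, x⟫`. -/
def facePoly (A : Finset (Rn n)) (F : Set (Rn n)) : MvPolynomial (Fin n) ℝ :=
  linForm (-outerNormal A F)

/-- The length of the orthogonal projection of `a` onto the hyperplane `u_F^⊥`. -/
def projLen (A : Finset (Rn n)) (F : Set (Rn n)) (a : Rn n) : ℝ :=
  ‖a - ⟪outerNormal A F, a⟫_ℝ • outerNormal A F‖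

/-- The normalized orthogonal projection `ã` of `a` onto the hyperplane `u_F^⊥`. -/
def tildeNormal (A : Finset (Rn n)) (F : Set (Rn n)) (a : Rn n) : Rn n :=
  (projLen A F a)⁻¹ • (a - ⟪outerNormal A F, a⟫_ℝ • outerNormal A F)

/-- The right-hand side `b̃` for which `⟪a, y - u_F⟫ ≤ 0 ↔ ⟪ã, y⟫ ≤ b̃` whenever `y ⟂ u_F`. -/
def tildeRhs (A : Finset (Rn n)) (F : Set (Rn n)) (a : Rn n) : ℝ :=
  (projLen A F a)⁻¹ * ⟪a, outerNormal A F⟫_ℝ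

/-- The polytope `P_μ`. For `μ = 0` it is the section of the pointed cone
`{x ∈ lin(F)^⊥ : ⟪a, x⟫ ≤ 0, a active}` at height `⟪-u_F, x⟫ = 1`, translated by `u_F` into
the linear space `lin(F)^⊥ ∩ u_F^⊥`; for `μ > 0` all its inequalities are relaxed by `μ`. -/
def basePolytope (A : Finset (Rn n)) (F : Set (Rn n)) (μ : ℝ) : Set (Rn n) :=
  {y | y ∈ (Submodule.span ℝ F)ᗮ ∧ ⟪outerNormal A F, y⟫_ℝ = 0 ∧
    ∀ a ∈ active A F, ⟪tildeNormal A F a, y⟫_ℝ ≤ tildeRhs A F a + μ}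

/-- The support function `h(a) = max {⟪a, x⟫ : x ∈ P}` of a polytope `P`. -/
def supportFn (P : Set (Rn n)) (a : Rn n) : ℝ := sSup ((fun x => ⟪a, x⟫_ℝ) '' P)

/-- `γ_F = max {(1 - ⟪a, u_F⟫²)^(-1/2) : a active}`. -/
def gammaConst (A : Finset (Rn n)) (F : Set (Rn n)) : ℝ :=
  sSup ((fun a => (Real.sqrt (1 - ⟪a, outerNormal A F⟫_ℝ ^ 2))⁻¹) ''
    (active A F : Set (Rn n)))

/-- The relaxation parameter `μ`, determined by `μ / (μ + γ_F) = ε`. -/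
def relax (A : Finset (Rn n)) (F : Set (Rn n)) (ε : ℝ) : ℝ :=
  ε / (1 - ε) * gammaConst A F

/-- The lower bound for the exponent in the approximation of the polytope `P_μ`, of dimension
`n - dim F - 1`, up to an error `ν = μ`:
`ln m / (2 ln (1 + 2 μ / ((n - dim F) diam P_μ)))`, with `m` the number of active constraints. -/
def exponentBound (A : Finset (Rn n)) (F : Set (Rn n)) (ε : ℝ) : ℝ :=
  Real.log ((active A F).card : ℝ) /
    (2 * Real.log (1 + 2 * relax A F ε /
      (((n : ℝ) - (coneDim F : ℝ)) * Metric.diam (basePolytope A F (relax A F ε)))))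

/-- With `P = P_μ`, `h` its support function, `s = ⟪-u_F, x⟫` and `m` the number of active
constraints, the polynomial
`s^(2q) - (1/m) ∑ ((2 ⟪ã, x⟫ - (h(ã) - h(-ã)) s) / (h(ã) + h(-ã)))^(2q)`. -/
def homogPoly (A : Finset (Rn n)) (F : Set (Rn n)) (ε : ℝ) (q : ℕ) : MvPolynomial (Fin n) ℝ :=
  let h : Rn n → ℝ := supportFn (basePolytope A F (relax A F ε))
  facePoly A F ^ (2 * q) -
    MvPolynomial.C (1 / ((active A F).card : ℝ)) *
      ∑ a ∈ active A F,
        (MvPolynomial.C (2 / (h (tildeNormal A F a) + h (-tildeNormal A F a))) *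
            linForm (tildeNormal A F a) -
          MvPolynomial.C ((h (tildeNormal A F a) - h (-tildeNormal A F a)) /
              (h (tildeNormal A F a) + h (-tildeNormal A F a))) *
            facePoly A F) ^ (2 * q)

/-- The approximating polynomial `p_{C_F, ε}` of the face-cone of `F`, with exponent `2q`. For
faces of dimension at least `n - 2` it is the linear form `p_F`. -/
def approxPoly (A : Finset (Rn n)) (F : Set (Rn n)) (ε : ℝ) (q : ℕ) : MvPolynomial (Fin n) ℝ :=
  if n ≤ coneDim F + 2 then facePoly A F else homogPoly A F ε q

/-- The product of the linear forms `p_F` over all `k`-faces `F`. -/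
def prodFace (A : Finset (Rn n)) (C : Set (Rn n)) (k : ℕ) : MvPolynomial (Fin n) ℝ :=
  ∏ᶠ F ∈ faces C k, facePoly A F

/-- The product of the polynomials `p_{C_F, ε_k}` over all `k`-faces `F`. -/
def prodApprox (A : Finset (Rn n)) (C : Set (Rn n)) (ε : ℕ → ℝ) (q : Set (Rn n) → ℕ) (k : ℕ) :
    MvPolynomial (Fin n) ℝ :=
  ∏ᶠ F ∈ faces C k, approxPoly A F (ε k) (q F)

/-- The `2n - 2` polynomials: `prodFace` for `k = 0, …, n - 1`, followed by `prodApprox` for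
`k = 0, …, n - 3`. -/
def conePolys (A : Finset (Rn n)) (C : Set (Rn n)) (ε : ℕ → ℝ) (q : Set (Rn n) → ℕ) :
    Fin (2 * n - 2) → MvPolynomial (Fin n) ℝ := fun i =>
  if (i : ℕ) < n then prodFace A C i else prodApprox A C ε q (i - n)

/-- The basic closed semi-algebraic set `{x : p_i(x) ≥ 0 for all i}`. -/
def semialgSet {ι : Type} (p : ι → MvPolynomial (Fin n) ℝ) : Set (Rn n) :=
  {x | ∀ i, 0 ≤ MvPolynomial.eval (fun j => x j) (p i)}

end ConePoly

end

noncomputable section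

namespace ConePoly

variable {n : ℕ}

/-! On `C` every single factor is nonnegative, hence so is every product. The content is the
converse: if all products are nonnegative at `x`, then so is every factor (`factors_nonneg`). This
suffices, because each constraint of a non-redundant representation is, up to a positive multiple,
`-p_F` for a facet `F` (`exists_facet`).

Two estimates control the polynomial of a face `F` of codimension at least three. It is positive
where `p_F > 0` and every active `a` satisfies `⟪a, x⟫ < ε p_F(x)` (`eval_homogPoly_pos`).
Conversely, where it and `p_F` are nonnegative, `⟪a, x⟫ ≤ 4 γ ε p_F(x)`
(`inner_le_of_eval_homogPoly_nonneg`). So its sign traps `x` in a thin neighbourhood of the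
face-cone of `F`.

The converse is a strong induction on the dimension `k`. If a factor of a `k`-face `G` is negative,
nonnegativity of the product forces a nonpositive factor at another `k`-face `F`. The face `H = F ∩
G` has smaller dimension `j`, so by induction `x` violates the constraints of `H` by at most a
multiple of `ε_j p_H(x)`. As `ε_j ≤ c ε_k`, this violation is negligible on the scale of `ε_k`, so a
bad factor at `F` or `G` forces `p_F(x)` or `p_G(x)` to be at most a multiple of `c p_H(x)`. Then
all constraints of `F` and `G` are nearly active at `x`. By compactness (`exists_bound_inter`),
`p_H(x)` is itself at most a multiple of `c p_H(x)`, so for small `c` it vanishes. Hence `x` lies in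
the linear hull of `H`, where the factors of `G` are zero and not negative
(`inner_eq_zero_of_close`). If `H` is a ridge there is no approximating polynomial; then `F` and `G`
are facets, and `p_H` is a positive combination of `p_F` and `p_G` (`ridge_contradiction`). -/

/-! ### Faces of a polyhedral cone and their linear hulls -/

lemma mem_active {A : Finset (Rn n)} {F : Set (Rn n)} {a : Rn n} :
    a ∈ active A F ↔ a ∈ A ∧ ∀ x ∈ F, ⟪a, x⟫_ℝ = 0 := by
  simp [active]

lemma active_subset (A : Finset (Rn n)) (F : Set (Rn n)) : active A F ⊆ A :=
  fun _ ha => (mem_active.1 ha).1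

lemma active_anti (A : Finset (Rn n)) {F G : Set (Rn n)} (h : F ⊆ G) :
    active A G ⊆ active A F := fun _ ha =>
  mem_active.2 ⟨(mem_active.1 ha).1, fun x hx => (mem_active.1 ha).2 x (h hx)⟩

lemma smul_mem_coneOf {A : Finset (Rn n)} {x : Rn n} (hx : x ∈ coneOf A) {t : ℝ} (ht : 0 ≤ t) :
    t • x ∈ coneOf A := fun a ha => by
  rw [real_inner_smul_right]
  exact mul_nonpos_of_nonneg_of_nonpos ht (hx a ha)

lemma zero_mem_coneOf (A : Finset (Rn n)) : (0 : Rn n) ∈ coneOf A := fun a _ => by simp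

/-- A non-empty exposed face of a polyhedral cone is the zero set of a linear form that is
nonpositive on the cone. -/
lemma exists_supporting {A : Finset (Rn n)} {F : Set (Rn n)} (hne : F.Nonempty)
    (hF : IsExposed ℝ (coneOf A) F) :
    ∃ l : Rn n →ₗ[ℝ] ℝ, (∀ x ∈ coneOf A, l x ≤ 0) ∧ F = {x ∈ coneOf A | l x = 0} := by
  obtain ⟨l, hl⟩ := hF hne
  obtain ⟨x, hx⟩ := hne
  have hx' := hx
  rw [hl] at hx'
  -- Comparing the maximiser `x` with `0` and with `2 • x` shows that the maximum over the cone is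
  -- `0`.
  have h0 := hx'.2 0 (zero_mem_coneOf A)
  have h2 := hx'.2 ((2 : ℝ) • x) (smul_mem_coneOf hx'.1 (by norm_num))
  simp only [map_zero, map_smul, smul_eq_mul] at h0 h2
  have hlx : l x = 0 := by linarith
  have hle : ∀ y ∈ coneOf A, l y ≤ 0 := fun y hy => hlx ▸ hx'.2 y hy
  refine ⟨l.toLinearMap, hle, ?_⟩
  rw [hl]
  ext y
  constructor
  · rintro ⟨hy, hm⟩
    exact ⟨hy, le_antisymm (hle y hy) (by simpa using hm 0 (zero_mem_coneOf A))⟩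
  · rintro ⟨hy, hm⟩
    exact ⟨hy, fun z hz => (hle z hz).trans_eq (Eq.symm hm)⟩

lemma zero_mem_face {A : Finset (Rn n)} {F : Set (Rn n)} (hne : F.Nonempty)
    (hF : IsExposed ℝ (coneOf A) F) : (0 : Rn n) ∈ F := by
  obtain ⟨l, -, rfl⟩ := exists_supporting hne hF
  exact ⟨zero_mem_coneOf A, map_zero l⟩

/-- A relative interior point of a face. -/
lemma exists_relint {A : Finset (Rn n)} {F : Set (Rn n)} (hne : F.Nonempty)
    (hF : IsExposed ℝ (coneOf A) F) :
    ∃ z ∈ F, ∀ a ∈ A, a ∉ active A F → ⟪a, z⟫_ℝ < 0 := by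
  obtain ⟨l, hl, rfl⟩ := exists_supporting hne hF
  set F := {x ∈ coneOf A | l x = 0}
  have h : ∀ a : Rn n, ∃ z ∈ F, a ∈ A → a ∉ active A F → ⟪a, z⟫_ℝ < 0 := by
    intro a
    by_cases ha : a ∈ A ∧ a ∉ active A F
    · rw [mem_active] at ha
      obtain ⟨haA, ha⟩ := ha
      push Not at ha
      obtain ⟨z, hz, hne⟩ := ha haA
      exact ⟨z, hz, fun _ _ => lt_of_le_of_ne (hz.1 a haA) hne⟩
    · exact ⟨0, ⟨zero_mem_coneOf A, map_zero l⟩, fun h1 h2 => absurd ⟨h1, h2⟩ ha⟩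
  choose z hzF hz using h
  -- Each inactive constraint is strict at some point of the face; the sum of these points is strict
  -- for all of them at once.
  refine ⟨∑ a ∈ A, z a, ⟨fun b hb => ?_, ?_⟩, fun b hb hb' => ?_⟩
  · rw [inner_sum]
    exact Finset.sum_nonpos fun a _ => (hzF a).1 b hb
  · rw [map_sum]
    exact Finset.sum_eq_zero fun a _ => (hzF a).2
  · rw [inner_sum]
    exact Finset.sum_neg' (fun a _ => (hzF a).1 b hb) ⟨b, hb, hz b hb hb'⟩

/-- Moving a little from a point in a given direction preserves strict inequalities. -/
lemma exists_pos_smul_lt (T : Finset (Rn n)) (y : Rn n) (f : Rn n → ℝ)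
    (hf : ∀ a ∈ T, 0 < f a) : ∃ t : ℝ, 0 < t ∧ ∀ a ∈ T, t * ⟪a, y⟫_ℝ < f a := by
  have h : ∀ a ∈ T, ∀ᶠ t : ℝ in nhdsWithin 0 (Set.Ioi 0), t * ⟪a, y⟫_ℝ < f a := by
    intro a ha
    have hc : Filter.Tendsto (fun t : ℝ => t * ⟪a, y⟫_ℝ) (nhds 0) (nhds (0 * ⟪a, y⟫_ℝ)) :=
      (continuous_id.mul continuous_const).tendsto 0
    rw [zero_mul] at hc
    exact (hc.eventually_lt_const (hf a ha)).filter_mono nhdsWithin_le_nhds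
  obtain ⟨t, ht, ht0⟩ := (((Filter.eventually_all_finset T).2 h).and
    (self_mem_nhdsWithin (a := (0 : ℝ)) (s := Set.Ioi 0))).exists
  exact ⟨t, ht0, ht⟩

/-- Let `z` be a relative interior point of the face and `y` a point of the cone where the active
constraints vanish. Then `z - t • y` stays in the cone for small `t > 0`, so the supporting form,
which vanishes at `z`, cannot be negative at `y`. -/
lemma face_eq {A : Finset (Rn n)} {F : Set (Rn n)} (hne : F.Nonempty)
    (hF : IsExposed ℝ (coneOf A) F) :
    F = {x ∈ coneOf A | ∀ a ∈ active A F, ⟪a, x⟫_ℝ = 0} := by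
  obtain ⟨z, hzF, hz⟩ := exists_relint hne hF
  obtain ⟨l, hl, hFl⟩ := exists_supporting hne hF
  ext y
  constructor
  · intro hy
    have hy' := hy
    rw [hFl] at hy'
    exact ⟨hy'.1, fun a ha => (mem_active.1 ha).2 y hy⟩
  · rintro ⟨hyC, hy⟩
    rw [hFl] at hzF ⊢
    classical
    obtain ⟨t, ht, hlt⟩ := exists_pos_smul_lt (A \ active A F) (-y) (fun a => -⟪a, z⟫_ℝ)
      fun a ha => by
        rw [Finset.mem_sdiff] at ha
        linarith [hz a ha.1 ha.2]
    have hmem : z - t • y ∈ coneOf A := fun a ha => by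
      rw [inner_sub_right, real_inner_smul_right]
      by_cases h : a ∈ active A F
      · rw [hy a h]
        linarith [hzF.1 a ha]
      · have := hlt a (Finset.mem_sdiff.2 ⟨ha, h⟩)
        rw [inner_neg_right] at this
        linarith
    have h1 := hl _ hmem
    rw [map_sub, map_smul, hzF.2, smul_eq_mul] at h1
    have h2 : 0 ≤ l y := by
      by_contra h
      nlinarith
    exact ⟨hyC, le_antisymm (hl y hyC) h2⟩

/-- A relative interior point of the face can be moved a little in any direction that annihilates
the active normals without leaving the face, so such a direction is a multiple of a difference of
two points of the face. -/
lemma mem_span_face {A : Finset (Rn n)} {F : Set (Rn n)} (hne : F.Nonempty)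
    (hF : IsExposed ℝ (coneOf A) F) {x : Rn n} :
    x ∈ Submodule.span ℝ F ↔ ∀ a ∈ active A F, ⟪a, x⟫_ℝ = 0 := by
  constructor
  · intro hx a ha
    induction hx using Submodule.span_induction with
    | mem y hy => exact (mem_active.1 ha).2 y hy
    | zero => simp
    | add y z _ _ h1 h2 => rw [inner_add_right, h1, h2, add_zero]
    | smul r y _ h => rw [real_inner_smul_right, h, mul_zero]
  · intro hx
    obtain ⟨z, hzF, hz⟩ := exists_relint hne hF
    classical
    obtain ⟨t, ht, hlt⟩ := exists_pos_smul_lt (A \ active A F) x (fun a => -⟪a, z⟫_ℝ)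
      fun a ha => by
        rw [Finset.mem_sdiff] at ha
        linarith [hz a ha.1 ha.2]
    have hFe := face_eq hne hF
    have hmem : z + t • x ∈ F := by
      rw [hFe]
      have hzF' := hzF
      rw [hFe] at hzF'
      refine ⟨fun a ha => ?_, fun a ha => ?_⟩
      · rw [inner_add_right, real_inner_smul_right]
        by_cases h : a ∈ active A F
        · rw [hx a h]
          linarith [hzF'.1 a ha]
        · linarith [hlt a (Finset.mem_sdiff.2 ⟨ha, h⟩)]
      · rw [inner_add_right, real_inner_smul_right, hx a ha, hzF'.2 a ha]
        simp
    have h : x = t⁻¹ • ((z + t • x) - z) := by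
      rw [add_sub_cancel_left, smul_smul, inv_mul_cancel₀ ht.ne', one_smul]
    rw [h]
    exact Submodule.smul_mem _ _
      (Submodule.sub_mem _ (Submodule.subset_span hmem) (Submodule.subset_span hzF))

lemma span_face_eq {A : Finset (Rn n)} {F : Set (Rn n)} (hne : F.Nonempty)
    (hF : IsExposed ℝ (coneOf A) F) :
    Submodule.span ℝ F = (Submodule.span ℝ (active A F : Set (Rn n)))ᗮ := by
  ext x
  rw [mem_span_face hne hF, Submodule.mem_orthogonal]
  constructor
  · intro h v hv
    induction hv using Submodule.span_induction with
    | mem y hy => exact h y hy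
    | zero => simp
    | add y z _ _ h1 h2 => rw [inner_add_left, h1, h2, add_zero]
    | smul r y _ h => rw [real_inner_smul_left, h, mul_zero]
  · intro h a ha
    exact h a (Submodule.subset_span ha)

lemma finrank_span_active {A : Finset (Rn n)} {F : Set (Rn n)} (hne : F.Nonempty)
    (hF : IsExposed ℝ (coneOf A) F) :
    Module.finrank ℝ (Submodule.span ℝ (active A F : Set (Rn n))) + coneDim F = n := by
  have h := (Submodule.span ℝ (active A F : Set (Rn n))).finrank_add_finrank_orthogonal
  rwa [← span_face_eq hne hF, finrank_euclideanSpace_fin] at h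

lemma face_injOn {A : Finset (Rn n)} {F G : Set (Rn n)} (hF : F.Nonempty)
    (hF' : IsExposed ℝ (coneOf A) F) (hG : G.Nonempty) (hG' : IsExposed ℝ (coneOf A) G)
    (h : active A F = active A G) : F = G := by
  rw [face_eq hF hF', face_eq hG hG', h]

/-- A face is determined by its active set, which is one of the finitely many subsets of `A`. -/
lemma finite_exposed (A : Finset (Rn n)) :
    {F : Set (Rn n) | F.Nonempty ∧ IsExposed ℝ (coneOf A) F}.Finite := by
  refine Set.Finite.of_finite_image (f := active A) (A.powerset.finite_toSet.subset ?_) ?_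
  · rintro _ ⟨F, -, rfl⟩
    exact Finset.mem_coe.2 (Finset.mem_powerset.2 (active_subset A F))
  · rintro F hF G hG h
    exact face_injOn hF.1 hF.2 hG.1 hG.2 h

lemma finite_faces (A : Finset (Rn n)) (k : ℕ) : (faces (coneOf A) k).Finite :=
  (finite_exposed A).subset fun _ hF => ⟨hF.1, hF.2.1⟩

/-- A face that is contained in a face of the same dimension coincides with it. -/
lemma face_eq_of_subset {A : Finset (Rn n)} {F G : Set (Rn n)} (hF : F.Nonempty)
    (hF' : IsExposed ℝ (coneOf A) F) (hG : G.Nonempty) (hG' : IsExposed ℝ (coneOf A) G)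
    (hsub : F ⊆ G) (hdim : coneDim G ≤ coneDim F) : F = G := by
  have hs : Submodule.span ℝ F = Submodule.span ℝ G :=
    Submodule.eq_of_le_of_finrank_le (Submodule.span_mono hsub) hdim
  refine face_injOn hF hF' hG hG' (Finset.Subset.antisymm (fun a ha => ?_) (active_anti A hsub))
  refine mem_active.2 ⟨(mem_active.1 ha).1, fun x hx => ?_⟩
  exact (mem_span_face hF hF').1 (hs ▸ Submodule.subset_span hx) a ha

/-- Two different `k`-faces meet in a face of smaller dimension. -/
lemma inter_mem_faces {A : Finset (Rn n)} {k : ℕ} {F G : Set (Rn n)}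
    (hF : F ∈ faces (coneOf A) k) (hG : G ∈ faces (coneOf A) k) (hne : F ≠ G) :
    ∃ j < k, F ∩ G ∈ faces (coneOf A) j := by
  have h0 : (F ∩ G).Nonempty := ⟨0, zero_mem_face hF.1 hF.2.1, zero_mem_face hG.1 hG.2.1⟩
  have hexp : IsExposed ℝ (coneOf A) (F ∩ G) := hF.2.1.inter hG.2.1
  refine ⟨coneDim (F ∩ G), ?_, h0, hexp, rfl⟩
  by_contra! h
  have h1 := face_eq_of_subset h0 hexp hF.1 hF.2.1 Set.inter_subset_left (hF.2.2.trans_le h)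
  have h2 := face_eq_of_subset h0 hexp hG.1 hG.2.1 Set.inter_subset_right (hG.2.2.trans_le h)
  exact hne (h1.symm.trans h2)

/-! ### Interior points and non-redundant representations -/

/-- A full-dimensional cone has an interior point. -/
lemma exists_interior {A : Finset (Rn n)} (hA : ∀ a ∈ A, ‖a‖ = 1) (hdim : coneDim (coneOf A) = n) :
    ∃ z : Rn n, ∀ a ∈ A, ⟪a, z⟫_ℝ < 0 := by
  have hexp : IsExposed ℝ (coneOf A) (coneOf A) := IsExposed.refl _
  have hne : (coneOf A).Nonempty := ⟨0, zero_mem_coneOf A⟩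
  obtain ⟨z, -, hz⟩ := exists_relint hne hexp
  refine ⟨z, fun a ha => hz a ha fun hact => ?_⟩
  have h := finrank_span_active hne hexp
  rw [hdim] at h
  have h0 : Submodule.span ℝ (active A (coneOf A) : Set (Rn n)) = ⊥ :=
    Submodule.finrank_eq_zero.1 (by omega)
  have : a = 0 := by
    have := Submodule.subset_span (R := ℝ) (Finset.mem_coe.2 hact)
    rwa [h0, SetLike.mem_coe, Submodule.mem_bot] at this
  have h1 := hA a ha
  rw [this, norm_zero] at h1
  exact zero_ne_one h1

/-- A violated constraint of a non-redundant representation. -/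
lemma IsNonredundantRep.exists_violating {A : Finset (Rn n)} {C : Set (Rn n)}
    (h : IsNonredundantRep A C) {a : Rn n} (ha : a ∈ A) :
    ∃ x : Rn n, 0 < ⟪a, x⟫_ℝ ∧ ∀ b ∈ A, b ≠ a → ⟪b, x⟫_ℝ ≤ 0 := by
  classical
  have h1 := h.nonredundant (A.erase a) (Finset.erase_ssubset ha)
  by_contra! hcon
  apply h1
  rw [h.eq_coneOf]
  ext x
  constructor
  · intro hx b hb
    by_cases hba : b = a
    · subst hba
      by_contra! hpos
      obtain ⟨b', hb', hne, hlt⟩ := hcon x hpos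
      exact absurd (hx b' (Finset.mem_erase.2 ⟨hne, hb'⟩)) (not_le.2 hlt)
    · exact hx b (Finset.mem_erase.2 ⟨hba, hb⟩)
  · intro hx b hb
    exact hx b (Finset.mem_of_mem_erase hb)

/-- A linear relation between the normal vectors has at least two negative coefficients. -/
lemma IsNonredundantRep.coeff_eq_zero {A : Finset (Rn n)} {C : Set (Rn n)}
    (h : IsNonredundantRep A C) (hint : ∃ z : Rn n, ∀ a ∈ A, ⟪a, z⟫_ℝ < 0)
    {T : Finset (Rn n)} (hT : T ⊆ A) {c : Rn n → ℝ} {a : Rn n} (ha : a ∈ T)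
    (hc : ∀ b ∈ T, b ≠ a → 0 ≤ c b) (hsum : ∑ b ∈ T, c b • b = 0) : ∀ b ∈ T, c b = 0 := by
  have hin : ∀ x : Rn n, ∑ b ∈ T, c b * ⟪b, x⟫_ℝ = 0 := fun x => by
    have := congrArg (fun v => ⟪v, x⟫_ℝ) hsum
    simpa [sum_inner, real_inner_smul_left] using this
  by_cases hca : 0 ≤ c a
  · obtain ⟨z, hz⟩ := hint
    have hc' : ∀ b ∈ T, 0 ≤ c b := fun b hb => by
      by_cases hba : b = a
      · rwa [hba]
      · exact hc b hb hba
    have h0 := (Finset.sum_eq_zero_iff_of_nonpos fun b hb =>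
      mul_nonpos_of_nonneg_of_nonpos (hc' b hb) (hz b (hT hb)).le).1 (hin z)
    exact fun b hb => (mul_eq_zero.1 (h0 b hb)).resolve_right (hz b (hT hb)).ne
  · push Not at hca
    obtain ⟨x, hx, hx'⟩ := h.exists_violating (hT ha)
    have : ∑ b ∈ T, c b * ⟪b, x⟫_ℝ < 0 := by
      refine Finset.sum_neg' (fun b hb => ?_) ⟨a, ha, mul_neg_of_neg_of_pos hca hx⟩
      by_cases hba : b = a
      · rw [hba]
        exact (mul_neg_of_neg_of_pos hca hx).le
      · exact mul_nonpos_of_nonneg_of_nonpos (hc b hb hba) (hx' b (hT hb) hba)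
    exact absurd (hin x) this.ne

/-- At most three of the normal vectors are always linearly independent. -/
lemma IsNonredundantRep.linearIndepOn {A : Finset (Rn n)} {C : Set (Rn n)}
    (h : IsNonredundantRep A C) (hint : ∃ z : Rn n, ∀ a ∈ A, ⟪a, z⟫_ℝ < 0)
    {T : Finset (Rn n)} (hT : T ⊆ A) (hcard : T.card ≤ 3) :
    LinearIndepOn ℝ id (T : Set (Rn n)) := by
  classical
  have key : ∀ c : Rn n → ℝ, ∑ b ∈ T, c b • b = 0 → (T.filter fun b => c b < 0).card ≤ 1 →
      ∀ b ∈ T, c b = 0 := by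
    intro c hsum hle b hb
    by_cases hex : ∃ a ∈ T, c a < 0
    · obtain ⟨a, ha, hca⟩ := hex
      refine h.coeff_eq_zero hint hT ha (fun b hb hba => ?_) hsum b hb
      by_contra! hcb
      exact hba (Finset.card_le_one.1 hle b (Finset.mem_filter.2 ⟨hb, hcb⟩) a
        (Finset.mem_filter.2 ⟨ha, hca⟩))
    · push Not at hex
      exact h.coeff_eq_zero hint hT hb (fun b hb _ => hex b hb) hsum b hb
  rw [linearIndepOn_finset_iff]
  intro c hsum
  by_cases hle : (T.filter fun b => c b < 0).card ≤ 1
  · exact key c hsum hle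
  -- Among at most three coefficients, either `c` or `-c` has at most one negative entry.
  · have hdis : Disjoint (T.filter fun b => c b < 0) (T.filter fun b => -c b < 0) := by
      rw [Finset.disjoint_filter]
      intro b _ h1 h2
      linarith
    have hsub : (T.filter fun b => c b < 0) ∪ (T.filter fun b => -c b < 0) ⊆ T :=
      Finset.union_subset (Finset.filter_subset _ _) (Finset.filter_subset _ _)
    have hc := Finset.card_le_card hsub
    rw [Finset.card_union_of_disjoint hdis] at hc
    intro b hb
    have := key (fun b => -c b) (by simpa [neg_smul] using hsum) (by omega) b hb
    linarith

/-- If there were more than `d ≤ 2` vectors, `d + 1 ≤ 3` of them would be independent in a space of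
dimension `d`. Hence facets have one active constraint and ridges two. -/
lemma IsNonredundantRep.card_le_of_finrank {A : Finset (Rn n)} {C : Set (Rn n)}
    (h : IsNonredundantRep A C) (hint : ∃ z : Rn n, ∀ a ∈ A, ⟪a, z⟫_ℝ < 0)
    {T : Finset (Rn n)} (hT : T ⊆ A) {d : ℕ} (hd : d ≤ 2)
    (hT' : Module.finrank ℝ (Submodule.span ℝ (T : Set (Rn n))) = d) : T.card ≤ d := by
  by_contra! hcard
  obtain ⟨S, hST, hS⟩ := Finset.exists_subset_card_eq (Nat.succ_le_of_lt hcard)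
  have hli := h.linearIndepOn hint (hST.trans hT) (by omega)
  have h1 : Module.finrank ℝ (Submodule.span ℝ (S : Set (Rn n))) = S.card :=
    finrank_span_finset_eq_card hli
  have h2 := Submodule.finrank_mono (R := ℝ) (Submodule.span_mono (R := ℝ) (Finset.coe_subset.2 hST))
  omega

/-- Every constraint of a non-redundant representation defines a facet. -/
lemma IsNonredundantRep.exists_facet {A : Finset (Rn n)} {C : Set (Rn n)}
    (h : IsNonredundantRep A C) (hint : ∃ z : Rn n, ∀ a ∈ A, ⟪a, z⟫_ℝ < 0)
    {a : Rn n} (ha : a ∈ A) : ∃ F ∈ faces C (n - 1), active A F = {a} := by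
  obtain ⟨z, hz⟩ := hint
  obtain ⟨x, hx, hx'⟩ := h.exists_violating ha
  -- The segment from the interior point `z` to the violating point `x` crosses the hyperplane of
  -- `a`; `y` is a positive multiple of the crossing point, and it keeps all other constraints
  -- strict.
  set y : Rn n := ⟪a, x⟫_ℝ • z - ⟪a, z⟫_ℝ • x
  have hya : ⟪a, y⟫_ℝ = 0 := by
    simp only [y, inner_sub_right, real_inner_smul_right]
    ring
  have hyb : ∀ b ∈ A, b ≠ a → ⟪b, y⟫_ℝ < 0 := fun b hb hba => by
    simp only [y, inner_sub_right, real_inner_smul_right]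
    nlinarith [mul_neg_of_pos_of_neg hx (hz b hb),
      mul_nonneg_of_nonpos_of_nonpos (hz a ha).le (hx' b hb hba)]
  have hyC : y ∈ coneOf A := fun b hb => by
    by_cases hba : b = a
    · rw [hba, hya]
    · exact (hyb b hb hba).le
  have hC := h.eq_coneOf
  subst hC
  set F : Set (Rn n) := {x ∈ coneOf A | ⟪a, x⟫_ℝ = 0}
  have hne : F.Nonempty := ⟨y, hyC, hya⟩
  have hexp : IsExposed ℝ (coneOf A) F := fun _ => by
    refine ⟨innerSL ℝ a, ?_⟩
    ext w
    constructor
    · rintro ⟨hw, hw'⟩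
      refine ⟨hw, fun v hv => ?_⟩
      rw [innerSL_apply_apply, innerSL_apply_apply, hw']
      exact hv a ha
    · rintro ⟨hw, hw'⟩
      refine ⟨hw, le_antisymm (hw a ha) ?_⟩
      simpa using hw' 0 (zero_mem_coneOf A)
  have hact : active A F = {a} := by
    ext b
    rw [mem_active, Finset.mem_singleton]
    constructor
    · rintro ⟨hb, hb'⟩
      by_contra hba
      exact (hyb b hb hba).ne (hb' y ⟨hyC, hya⟩)
    · rintro rfl
      exact ⟨ha, fun w hw => hw.2⟩
  refine ⟨F, ⟨hne, hexp, ?_⟩, hact⟩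
  have hr := finrank_span_active hne hexp
  have ha0 : a ≠ 0 := fun h0 => by
    have := h.norm_eq_one a ha
    rw [h0, norm_zero] at this
    exact zero_ne_one this
  rw [hact, Finset.coe_singleton, finrank_span_singleton ha0] at hr
  omega

/-- Every polyhedral cone has a non-redundant representation by unit vectors. -/
lemma IsPolyhedralCone.exists_nonredundantRep {C : Set (Rn n)} (hC : IsPolyhedralCone C) :
    ∃ A : Finset (Rn n), IsNonredundantRep A C := by
  classical
  obtain ⟨A₀, hA₀⟩ := hC
  have hunit : ∃ A : Finset (Rn n), (∀ a ∈ A, ‖a‖ = 1) ∧ C = coneOf A := by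
    refine ⟨(A₀.erase 0).image fun a => ‖a‖⁻¹ • a, ?_, ?_⟩
    · intro a ha
      obtain ⟨b, hb, rfl⟩ := Finset.mem_image.1 ha
      have hb0 : ‖b‖ ≠ 0 := norm_ne_zero_iff.2 (Finset.ne_of_mem_erase hb)
      rw [norm_smul, norm_inv, norm_norm, inv_mul_cancel₀ hb0]
    · rw [hA₀]
      ext x
      constructor
      · intro hx a ha
        obtain ⟨b, hb, rfl⟩ := Finset.mem_image.1 ha
        rw [real_inner_smul_left]
        exact mul_nonpos_of_nonneg_of_nonpos (inv_nonneg.2 (norm_nonneg b))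
          (hx b (Finset.mem_of_mem_erase hb))
      · intro hx a ha
        by_cases h0 : a = 0
        · simp [h0]
        · have h1 := hx _ (Finset.mem_image_of_mem _ (Finset.mem_erase.2 ⟨h0, ha⟩))
          rw [real_inner_smul_left] at h1
          by_contra! hpos
          exact absurd h1 (not_le.2 (mul_pos (inv_pos.2 (norm_pos_iff.2 h0)) hpos))
  obtain ⟨A₁, hA₁, hC₁⟩ := hunit
  obtain ⟨A, hA, hmin⟩ := (A₁.powerset.filter fun B => C = coneOf B).exists_minimal
    ⟨A₁, Finset.mem_filter.2 ⟨Finset.mem_powerset_self _, hC₁⟩⟩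
  rw [Finset.mem_filter, Finset.mem_powerset] at hA
  refine ⟨A, fun a ha => hA₁ a (hA.1 ha), hA.2, fun B hB hBC => ?_⟩
  have hle := hmin (Finset.mem_filter.2 ⟨Finset.mem_powerset.2 (hB.1.trans hA.1), hBC.symm⟩) hB.1
  exact hB.2 hle

/-! ### Evaluation of the polynomials -/

lemma eval_linForm (v x : Rn n) :
    MvPolynomial.eval (fun j => x j) (linForm v) = ⟪v, x⟫_ℝ := by
  simp [linForm, PiLp.inner_apply, mul_comm]

lemma eval_facePoly (A : Finset (Rn n)) (F : Set (Rn n)) (x : Rn n) :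
    MvPolynomial.eval (fun j => x j) (facePoly A F) = -⟪outerNormal A F, x⟫_ℝ := by
  rw [facePoly, eval_linForm, inner_neg_left]

lemma eval_homogPoly (A : Finset (Rn n)) (F : Set (Rn n)) (ε : ℝ) (q : ℕ) (x : Rn n) :
    MvPolynomial.eval (fun j => x j) (homogPoly A F ε q) =
      (-⟪outerNormal A F, x⟫_ℝ) ^ (2 * q) - 1 / ((active A F).card : ℝ) *
        ∑ a ∈ active A F,
          (2 / (supportFn (basePolytope A F (relax A F ε)) (tildeNormal A F a) +
              supportFn (basePolytope A F (relax A F ε)) (-tildeNormal A F a)) *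
              ⟪tildeNormal A F a, x⟫_ℝ -
            (supportFn (basePolytope A F (relax A F ε)) (tildeNormal A F a) -
              supportFn (basePolytope A F (relax A F ε)) (-tildeNormal A F a)) /
            (supportFn (basePolytope A F (relax A F ε)) (tildeNormal A F a) +
              supportFn (basePolytope A F (relax A F ε)) (-tildeNormal A F a)) *
              (-⟪outerNormal A F, x⟫_ℝ)) ^ (2 * q) := by
  simp only [homogPoly, map_sub, map_mul, map_pow, map_sum, MvPolynomial.eval_C, eval_facePoly,
    eval_linForm]

/-! ### Outer normals and projected constraint normals of a proper face -/

/-- The data shared by the following lemmas: a face of codimension at least one of a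
full-dimensional cone with a non-redundant representation. -/
structure IsProperFace (A : Finset (Rn n)) (F : Set (Rn n)) : Prop where
  rep : IsNonredundantRep A (coneOf A)
  interior : ∃ z : Rn n, ∀ a ∈ A, ⟪a, z⟫_ℝ < 0
  nonempty : F.Nonempty
  exposed : IsExposed ℝ (coneOf A) F
  dim_lt : coneDim F < n

namespace IsProperFace

variable {A : Finset (Rn n)} {F : Set (Rn n)}

lemma active_nonempty (h : IsProperFace A F) : (active A F).Nonempty := by
  by_contra hcon
  rw [Finset.not_nonempty_iff_eq_empty] at hcon
  have h1 := finrank_span_active h.nonempty h.exposed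
  have h2 := h.dim_lt
  rw [hcon, Finset.coe_empty, Submodule.span_empty, finrank_bot] at h1
  omega

/-- The sum of the active normals has negative inner product with an interior point, so it can be
normalised. -/
lemma norm_sum_pos (h : IsProperFace A F) : 0 < ‖∑ a ∈ active A F, a‖ := by
  rw [norm_pos_iff]
  intro h0
  obtain ⟨z, hz⟩ := h.interior
  have h1 : ∑ a ∈ active A F, ⟪a, z⟫_ℝ < 0 :=
    Finset.sum_neg (fun a ha => hz a (active_subset A F ha)) h.active_nonempty
  rw [← sum_inner, h0, inner_zero_left] at h1
  exact lt_irrefl _ h1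

lemma norm_outerNormal (h : IsProperFace A F) : ‖outerNormal A F‖ = 1 := by
  rw [outerNormal, norm_smul, norm_inv, norm_norm, inv_mul_cancel₀ h.norm_sum_pos.ne']

lemma smul_outerNormal (h : IsProperFace A F) :
    ‖∑ a ∈ active A F, a‖ • outerNormal A F = ∑ a ∈ active A F, a := by
  rw [outerNormal, smul_smul, mul_inv_cancel₀ h.norm_sum_pos.ne', one_smul]

/-- Up to a positive factor, `p_F` is minus the sum of the active constraints; sign statements about
`p_F` are read off from this identity. -/
lemma norm_mul_inner (h : IsProperFace A F) (x : Rn n) :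
    ‖∑ a ∈ active A F, a‖ * ⟪outerNormal A F, x⟫_ℝ = ∑ a ∈ active A F, ⟪a, x⟫_ℝ := by
  rw [← real_inner_smul_left, h.smul_outerNormal, sum_inner]

lemma norm_sum_le (h : IsProperFace A F) : ‖∑ a ∈ active A F, a‖ ≤ A.card := by
  calc ‖∑ a ∈ active A F, a‖ ≤ ∑ a ∈ active A F, ‖a‖ := _root_.norm_sum_le _ _
    _ = ∑ a ∈ active A F, 1 :=
        Finset.sum_congr rfl fun a ha => h.rep.norm_eq_one a (active_subset A F ha)
    _ ≤ A.card := by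
        rw [Finset.sum_const, nsmul_eq_mul, mul_one, Nat.cast_le]
        exact Finset.card_le_card (active_subset A F)

lemma inner_eq_zero_of_nonpos (h : IsProperFace A F) {x : Rn n}
    (hx : ∀ a ∈ active A F, ⟪a, x⟫_ℝ ≤ 0) (h0 : ⟪outerNormal A F, x⟫_ℝ = 0) :
    ∀ a ∈ active A F, ⟪a, x⟫_ℝ = 0 := by
  have h1 := h.norm_mul_inner x
  rw [h0, mul_zero] at h1
  exact (Finset.sum_eq_zero_iff_of_nonpos hx).1 h1.symm

lemma inner_outerNormal_eq_zero (h : IsProperFace A F) {x : Rn n}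
    (hx : ∀ a ∈ active A F, ⟪a, x⟫_ℝ = 0) : ⟪outerNormal A F, x⟫_ℝ = 0 := by
  have h1 := h.norm_mul_inner x
  rw [Finset.sum_eq_zero hx] at h1
  exact (mul_eq_zero.1 h1).resolve_left h.norm_sum_pos.ne'

lemma inner_outerNormal_nonpos (h : IsProperFace A F) {x : Rn n}
    (hx : ∀ a ∈ active A F, ⟪a, x⟫_ℝ ≤ 0) : ⟪outerNormal A F, x⟫_ℝ ≤ 0 := by
  have h1 := h.norm_mul_inner x
  have h2 := Finset.sum_nonpos hx
  by_contra! hpos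
  nlinarith [mul_pos h.norm_sum_pos hpos]

lemma projLen_sq (h : IsProperFace A F) {a : Rn n} (ha : a ∈ active A F) :
    projLen A F a ^ 2 = 1 - ⟪a, outerNormal A F⟫_ℝ ^ 2 := by
  have hu : ⟪outerNormal A F, outerNormal A F⟫_ℝ = 1 := by
    rw [real_inner_self_eq_norm_sq, h.norm_outerNormal, one_pow]
  have ha' : ⟪a, a⟫_ℝ = 1 := by
    rw [real_inner_self_eq_norm_sq, h.rep.norm_eq_one a (active_subset A F ha), one_pow]
  rw [projLen, ← real_inner_self_eq_norm_sq, inner_sub_left, inner_sub_right, inner_sub_right,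
    real_inner_smul_left, real_inner_smul_right, real_inner_smul_right, real_inner_smul_left,
    hu, ha', real_inner_comm]
  ring

lemma projLen_le_one (h : IsProperFace A F) {a : Rn n} (ha : a ∈ active A F) :
    projLen A F a ≤ 1 := by
  have := h.projLen_sq ha
  nlinarith [sq_nonneg ⟪a, outerNormal A F⟫_ℝ]

/-- If the projection of `a` vanished, the sum of the active normals would be a multiple of `a`.
This is a relation whose coefficients away from `a` are all `1`, and codimension at least two
provides a second active normal, contradicting `coeff_eq_zero`. -/
lemma projLen_pos (h : IsProperFace A F) (hdim : coneDim F + 2 ≤ n) {a : Rn n}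
    (ha : a ∈ active A F) : 0 < projLen A F a := by
  classical
  rw [projLen, norm_pos_iff]
  intro h0
  obtain ⟨b, hb, hba⟩ : ∃ b ∈ active A F, b ≠ a := by
    by_contra! hcon
    have hact : active A F = {a} := Finset.eq_singleton_iff_unique_mem.2 ⟨ha, hcon⟩
    have h1 := finrank_span_active h.nonempty h.exposed
    rw [hact, Finset.coe_singleton] at h1
    have h2 := finrank_span_le_card (R := ℝ) ({a} : Set (Rn n))
    simp at h2
    omega
  set r : ℝ := ⟪outerNormal A F, a⟫_ℝ
  set s : ℝ := ‖∑ a ∈ active A F, a‖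
  have hs : 0 < s := h.norm_sum_pos
  have hr : r ≠ 0 := fun hr => by
    rw [hr, zero_smul, sub_zero] at h0
    have := h.rep.norm_eq_one a (active_subset A F ha)
    rw [h0, norm_zero] at this
    exact zero_ne_one this
  have hu : (s / r) • a = ∑ b ∈ active A F, b := by
    rw [← h.smul_outerNormal]
    nth_rewrite 1 [sub_eq_zero.1 h0]
    rw [smul_smul, div_mul_cancel₀ _ hr]
  have hc := h.rep.coeff_eq_zero h.interior (active_subset A F)
    (c := fun b => 1 - if b = a then s / r else 0) ha
    (fun b _ hba => by simp [hba]) (by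
      simp [sub_smul, ite_smul, Finset.sum_sub_distrib, ha, hu]) b hb
  simp [hba] at hc

lemma projLen_mul_inner_tilde (h : IsProperFace A F) (hdim : coneDim F + 2 ≤ n) {a : Rn n}
    (ha : a ∈ active A F) (x : Rn n) :
    projLen A F a * ⟪tildeNormal A F a, x⟫_ℝ =
      ⟪a, x⟫_ℝ - ⟪a, outerNormal A F⟫_ℝ * ⟪outerNormal A F, x⟫_ℝ := by
  rw [tildeNormal, real_inner_smul_left, mul_inv_cancel_left₀ (h.projLen_pos hdim ha).ne',
    inner_sub_left, real_inner_smul_left, real_inner_comm a]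

lemma norm_tilde (h : IsProperFace A F) (hdim : coneDim F + 2 ≤ n) {a : Rn n}
    (ha : a ∈ active A F) : ‖tildeNormal A F a‖ = 1 := by
  have hp := h.projLen_pos hdim ha
  rw [tildeNormal, norm_smul, norm_inv, Real.norm_of_nonneg hp.le]
  exact inv_mul_cancel₀ hp.ne'

lemma active_mem_orthogonal {a : Rn n} (h : IsProperFace A F) (ha : a ∈ active A F) :
    a ∈ (Submodule.span ℝ F)ᗮ := by
  rw [Submodule.mem_orthogonal]
  intro x hx
  rw [real_inner_comm]
  exact (mem_span_face h.nonempty h.exposed).1 hx a ha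

lemma outerNormal_mem_orthogonal (h : IsProperFace A F) :
    outerNormal A F ∈ (Submodule.span ℝ F)ᗮ :=
  Submodule.smul_mem _ _ (Submodule.sum_mem _ fun _ ha => h.active_mem_orthogonal ha)

lemma tilde_mem_orthogonal (h : IsProperFace A F) {a : Rn n} (ha : a ∈ active A F) :
    tildeNormal A F a ∈ (Submodule.span ℝ F)ᗮ :=
  Submodule.smul_mem _ _ (Submodule.sub_mem _ (h.active_mem_orthogonal ha)
    (Submodule.smul_mem _ _ h.outerNormal_mem_orthogonal))

lemma inner_outerNormal_tilde (h : IsProperFace A F) (a : Rn n) :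
    ⟪outerNormal A F, tildeNormal A F a⟫_ℝ = 0 := by
  rw [tildeNormal, real_inner_smul_right, inner_sub_right, real_inner_smul_right,
    real_inner_self_eq_norm_sq, h.norm_outerNormal]
  ring

lemma one_le_gamma_mul (h : IsProperFace A F) (hdim : coneDim F + 2 ≤ n) {a : Rn n}
    (ha : a ∈ active A F) : 1 ≤ gammaConst A F * projLen A F a := by
  have hp := h.projLen_pos hdim ha
  have h1 : (projLen A F a)⁻¹ ≤ gammaConst A F := by
    refine le_csSup (((active A F).finite_toSet.image _).bddAbove) ⟨a, ha, ?_⟩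
    simp only
    rw [← h.projLen_sq ha, Real.sqrt_sq hp.le]
  calc (1 : ℝ) = (projLen A F a)⁻¹ * projLen A F a := (inv_mul_cancel₀ hp.ne').symm
    _ ≤ _ := mul_le_mul_of_nonneg_right h1 hp.le

lemma gamma_pos (h : IsProperFace A F) (hdim : coneDim F + 2 ≤ n) : 0 < gammaConst A F := by
  obtain ⟨a, ha⟩ := h.active_nonempty
  have := h.one_le_gamma_mul hdim ha
  exact pos_of_mul_pos_left (zero_lt_one.trans_le this) (h.projLen_pos hdim ha).le

lemma relax_pos (h : IsProperFace A F) (hdim : coneDim F + 2 ≤ n) {ε : ℝ} (h0 : 0 < ε)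
    (h1 : ε ≤ 1 / 2) : 0 < relax A F ε :=
  mul_pos (div_pos h0 (by linarith)) (h.gamma_pos hdim)

lemma relax_le (h : IsProperFace A F) (hdim : coneDim F + 2 ≤ n) {ε : ℝ} (h0 : 0 < ε)
    (h1 : ε ≤ 1 / 2) : relax A F ε ≤ 2 * ε * gammaConst A F := by
  refine mul_le_mul_of_nonneg_right ?_ (h.gamma_pos hdim).le
  rw [div_le_iff₀ (by linarith)]
  nlinarith

/-- A slack of `ε p_F(x)` in the constraint of `a` becomes, after passing to the section and
normalising by the projected length, a slack of at most `μ`. The choice of `μ` through the maximum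
`γ` makes this work for all active constraints. -/
lemma le_relax_mul (h : IsProperFace A F) (hdim : coneDim F + 2 ≤ n) {ε : ℝ} (h0 : 0 < ε)
    (h1 : ε ≤ 1 / 2) {a : Rn n} (ha : a ∈ active A F) :
    ε ≤ relax A F ε * projLen A F a := by
  have h2 := h.one_le_gamma_mul hdim ha
  have h3 : ε ≤ ε / (1 - ε) := by
    rw [le_div_iff₀ (by linarith)]
    nlinarith
  rw [relax, mul_assoc]
  nlinarith

/-! ### The section polytope and its support function -/

/-- Points off the hyperplane `u_F^⊥` are projected centrally into `lin(F)^⊥ ∩ u_F^⊥`. -/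
lemma exists_section (h : IsProperFace A F) (hdim : coneDim F + 2 ≤ n) {x : Rn n}
    (hx : 0 < -⟪outerNormal A F, x⟫_ℝ) :
    ∃ y ∈ (Submodule.span ℝ F)ᗮ, ⟪outerNormal A F, y⟫_ℝ = 0 ∧ ∀ a ∈ active A F,
      ⟪tildeNormal A F a, x⟫_ℝ = -⟪outerNormal A F, x⟫_ℝ * ⟪tildeNormal A F a, y⟫_ℝ ∧
      ⟪a, x⟫_ℝ = -⟪outerNormal A F, x⟫_ℝ * projLen A F a *
        (⟪tildeNormal A F a, y⟫_ℝ - tildeRhs A F a) := by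
  set s : ℝ := -⟪outerNormal A F, x⟫_ℝ
  set W := (Submodule.span ℝ F)ᗮ
  -- Scale `x` to height `1` and translate by `u_F` into `u_F^⊥`. Projecting to `lin(F)^⊥` then
  -- changes no inner product with `u_F` or with a projected normal, as these all lie in `lin(F)^⊥`.
  set w : Rn n := s⁻¹ • x + outerNormal A F
  have hproj : ∀ v ∈ W, ⟪v, W.starProjection w⟫_ℝ = ⟪v, w⟫_ℝ := fun v hv => by
    rw [← Submodule.inner_starProjection_left_eq_right,
      Submodule.starProjection_eq_self_iff.2 hv]
  have hu : ⟪outerNormal A F, W.starProjection w⟫_ℝ = 0 := by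
    rw [hproj _ h.outerNormal_mem_orthogonal, inner_add_right, real_inner_smul_right,
      real_inner_self_eq_norm_sq, h.norm_outerNormal, show ⟪outerNormal A F, x⟫_ℝ = -s by simp [s]]
    field_simp
    norm_num
  refine ⟨W.starProjection w, Submodule.starProjection_apply_mem _ _, hu, fun a ha => ?_⟩
  have ht : ⟪tildeNormal A F a, x⟫_ℝ = s * ⟪tildeNormal A F a, W.starProjection w⟫_ℝ := by
    rw [hproj _ (h.tilde_mem_orthogonal ha), inner_add_right, real_inner_smul_right,
      real_inner_comm (outerNormal A F), h.inner_outerNormal_tilde, add_zero,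
      mul_inv_cancel_left₀ hx.ne']
  refine ⟨ht, ?_⟩
  have h1 := h.projLen_mul_inner_tilde hdim ha x
  have hp := (h.projLen_pos hdim ha).ne'
  have h2 : projLen A F a * tildeRhs A F a = ⟪a, outerNormal A F⟫_ℝ := by
    rw [tildeRhs, mul_inv_cancel_left₀ hp]
  rw [ht] at h1
  have h3 : ⟪outerNormal A F, x⟫_ℝ = -s := by simp [s]
  rw [h3, ← h2] at h1
  linear_combination -h1

/-- The left-hand side pairs `y` with the projection to `u_F^⊥` of the sum of the active normals,
which is a multiple of `u_F`. This positive relation is what makes the section bounded. -/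
lemma tilde_relation (h : IsProperFace A F) (hdim : coneDim F + 2 ≤ n) (y : Rn n) :
    ∑ a ∈ active A F, projLen A F a * ⟪tildeNormal A F a, y⟫_ℝ = 0 := by
  have h1 : ∑ a ∈ active A F, projLen A F a * ⟪tildeNormal A F a, y⟫_ℝ =
      ∑ a ∈ active A F, (⟪a, y⟫_ℝ - ⟪a, outerNormal A F⟫_ℝ * ⟪outerNormal A F, y⟫_ℝ) :=
    Finset.sum_congr rfl fun a ha => h.projLen_mul_inner_tilde hdim ha y
  rw [h1, Finset.sum_sub_distrib, ← Finset.sum_mul, ← sum_inner, ← sum_inner,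
    ← h.smul_outerNormal, real_inner_smul_left, real_inner_smul_left,
    real_inner_self_eq_norm_sq, h.norm_outerNormal]
  ring

lemma isBounded_basePolytope (h : IsProperFace A F) (hdim : coneDim F + 2 ≤ n) (μ : ℝ) :
    Bornology.IsBounded (basePolytope A F μ) := by
  classical
  set W := (Submodule.span ℝ F)ᗮ
  obtain ⟨B, hB0, hB⟩ : ∃ B : ℝ, 0 ≤ B ∧ ∀ y ∈ basePolytope A F μ, ∀ a ∈ active A F,
      projLen A F a * ⟪tildeNormal A F a, y⟫_ℝ ≤ B := by
    refine ⟨∑ a ∈ active A F, |projLen A F a * (tildeRhs A F a + μ)|,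
      Finset.sum_nonneg fun _ _ => abs_nonneg _, fun y hy a ha => ?_⟩
    calc _ ≤ projLen A F a * (tildeRhs A F a + μ) :=
          mul_le_mul_of_nonneg_left (hy.2.2 a ha) (h.projLen_pos hdim ha).le
      _ ≤ |projLen A F a * (tildeRhs A F a + μ)| := le_abs_self _
      _ ≤ _ := Finset.single_le_sum (f := fun a => |projLen A F a * (tildeRhs A F a + μ)|)
          (fun _ _ => abs_nonneg _) ha
  -- By the positive relation, an upper bound on all constraints is also a lower bound on each.
  have hB' : ∀ y ∈ basePolytope A F μ, ∀ a ∈ active A F,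
      |⟪a, y⟫_ℝ| ≤ (active A F).card * B := by
    intro y hy a ha
    have h1 := h.projLen_mul_inner_tilde hdim ha y
    rw [hy.2.1, mul_zero, sub_zero] at h1
    have h2 := h.tilde_relation hdim y
    rw [← Finset.add_sum_erase _ _ ha] at h2
    have h3 : ∑ b ∈ (active A F).erase a, projLen A F b * ⟪tildeNormal A F b, y⟫_ℝ ≤
        ((active A F).erase a).card • B :=
      Finset.sum_le_card_nsmul _ _ _ fun b hb => hB y hy b (Finset.mem_of_mem_erase hb)
    rw [nsmul_eq_mul] at h3
    have h4 : (((active A F).erase a).card : ℝ) + 1 = (active A F).card := by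
      exact_mod_cast Finset.card_erase_add_one ha
    have h5 := hB y hy a ha
    have h6 : (0 : ℝ) ≤ ((active A F).erase a).card := Nat.cast_nonneg _
    rw [← h4, abs_le]
    constructor <;> nlinarith
  -- The active constraints serve as coordinates on `lin(F)^⊥`: their common kernel is `lin(F)`, so
  -- bounds on them bound the norm.
  let f : W →ₗ[ℝ] (active A F → ℝ) :=
    LinearMap.pi fun a => (innerₛₗ ℝ (a : Rn n)).comp W.subtype
  have hker : LinearMap.ker f = ⊥ := by
    rw [LinearMap.ker_eq_bot']
    rintro ⟨y, hy⟩ hfy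
    have hy' : y ∈ Submodule.span ℝ F := by
      rw [mem_span_face h.nonempty h.exposed]
      intro a ha
      exact congrFun hfy ⟨a, ha⟩
    rw [Submodule.mk_eq_zero]
    exact inner_self_eq_zero (𝕜 := ℝ).1 (hy y hy')
  obtain ⟨K, -, hK⟩ := f.exists_antilipschitzWith hker
  refine (Metric.isBounded_closedBall (x := (0 : Rn n))
    (r := K * ((active A F).card * B))).subset fun y hy => ?_
  have h1 := hK.le_mul_dist ⟨y, hy.1⟩ 0
  rw [map_zero, dist_zero_right, dist_zero_right] at h1
  rw [mem_closedBall_zero_iff]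
  refine h1.trans (mul_le_mul_of_nonneg_left ?_ K.2)
  rw [pi_norm_le_iff_of_nonneg (mul_nonneg (Nat.cast_nonneg _) hB0)]
  rintro ⟨a, ha⟩
  exact hB' y hy a ha

lemma le_supportFn (h : IsProperFace A F) (hdim : coneDim F + 2 ≤ n) {μ : ℝ} {y : Rn n}
    (hy : y ∈ basePolytope A F μ) (v : Rn n) :
    ⟪v, y⟫_ℝ ≤ supportFn (basePolytope A F μ) v := by
  refine le_csSup ?_ ⟨y, hy, rfl⟩
  obtain ⟨R, hR⟩ := (h.isBounded_basePolytope hdim μ).exists_norm_le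
  refine ⟨‖v‖ * R, ?_⟩
  rintro _ ⟨w, hw, rfl⟩
  exact (real_inner_le_norm v w).trans (mul_le_mul_of_nonneg_left (hR w hw) (norm_nonneg v))

lemma supportFn_add_le_diam (h : IsProperFace A F) (hdim : coneDim F + 2 ≤ n) {μ : ℝ}
    (hne : (basePolytope A F μ).Nonempty) {v : Rn n} (hv : ‖v‖ = 1) :
    supportFn (basePolytope A F μ) v + supportFn (basePolytope A F μ) (-v) ≤
      Metric.diam (basePolytope A F μ) := by
  rw [← le_sub_iff_add_le]
  refine csSup_le (hne.image _) ?_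
  rintro _ ⟨y, hy, rfl⟩
  rw [le_sub_comm]
  refine csSup_le (hne.image _) ?_
  rintro _ ⟨z, hz, rfl⟩
  have h1 := Metric.dist_le_diam_of_mem (h.isBounded_basePolytope hdim μ) hy hz
  have h2 := real_inner_le_norm v (y - z)
  rw [hv, one_mul, inner_sub_right, ← dist_eq_norm] at h2
  simp only [inner_neg_left]
  linarith

/-- A strictly feasible point can be moved a little in the direction `v`, which increases the inner
product with `v`. -/
lemma lt_supportFn (h : IsProperFace A F) (hdim : coneDim F + 2 ≤ n) {μ : ℝ} {y : Rn n}
    (hyW : y ∈ (Submodule.span ℝ F)ᗮ) (hyu : ⟪outerNormal A F, y⟫_ℝ = 0)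
    (hy : ∀ a ∈ active A F, ⟪tildeNormal A F a, y⟫_ℝ < tildeRhs A F a + μ) {v : Rn n}
    (hvW : v ∈ (Submodule.span ℝ F)ᗮ) (hvu : ⟪outerNormal A F, v⟫_ℝ = 0) (hv : v ≠ 0) :
    ⟪v, y⟫_ℝ < supportFn (basePolytope A F μ) v := by
  classical
  have hev : ∀ a ∈ active A F, ∀ᶠ t : ℝ in nhdsWithin 0 (Set.Ioi 0),
      ⟪tildeNormal A F a, y + t • v⟫_ℝ < tildeRhs A F a + μ := by
    intro a ha
    have hc : Continuous fun t : ℝ => ⟪tildeNormal A F a, y + t • v⟫_ℝ := by fun_prop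
    have h0 := hc.tendsto 0
    rw [zero_smul, add_zero] at h0
    exact (h0.eventually_lt_const (hy a ha)).filter_mono nhdsWithin_le_nhds
  obtain ⟨t, ht, ht0⟩ := (((Filter.eventually_all_finset (active A F)).2 hev).and
    (self_mem_nhdsWithin (a := (0 : ℝ)) (s := Set.Ioi 0))).exists
  have hmem : y + t • v ∈ basePolytope A F μ :=
    ⟨Submodule.add_mem _ hyW (Submodule.smul_mem _ _ hvW),
      by rw [inner_add_right, real_inner_smul_right, hyu, hvu]; simp,
      fun a ha => (ht a ha).le⟩
  have h1 := h.le_supportFn hdim hmem v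
  rw [inner_add_right, real_inner_smul_right] at h1
  have h2 : 0 < t * ⟪v, v⟫_ℝ := mul_pos ht0 (real_inner_self_pos.2 hv)
  linarith

/-- A point of the relative interior of the section of the cone. -/
lemma exists_strict (h : IsProperFace A F) (hdim : coneDim F + 2 ≤ n) {μ : ℝ} (hμ : 0 < μ) :
    ∃ y ∈ (Submodule.span ℝ F)ᗮ, ⟪outerNormal A F, y⟫_ℝ = 0 ∧
      ∀ a ∈ active A F, ⟪tildeNormal A F a, y⟫_ℝ < tildeRhs A F a + μ := by
  obtain ⟨z, hz⟩ := h.interior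
  have hs : 0 < -⟪outerNormal A F, z⟫_ℝ := by
    have h1 := h.norm_mul_inner z
    have h2 : ∑ a ∈ active A F, ⟪a, z⟫_ℝ < 0 :=
      Finset.sum_neg (fun a ha => hz a (active_subset A F ha)) h.active_nonempty
    rw [← h1] at h2
    linarith [neg_of_mul_neg_right h2 h.norm_sum_pos.le]
  obtain ⟨y, hyW, hyu, hy⟩ := h.exists_section hdim hs
  refine ⟨y, hyW, hyu, fun a ha => ?_⟩
  have h1 := hz a (active_subset A F ha)
  rw [(hy a ha).2] at h1
  linarith [neg_of_mul_neg_right h1 (mul_pos hs (h.projLen_pos hdim ha)).le]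

lemma tilde_ne_zero (h : IsProperFace A F) (hdim : coneDim F + 2 ≤ n) {a : Rn n}
    (ha : a ∈ active A F) : tildeNormal A F a ≠ 0 := fun h0 => by
  have := h.norm_tilde hdim ha
  rw [h0, norm_zero] at this
  exact zero_ne_one this

/-- Strictly feasible points lie strictly between the supporting hyperplanes with normal
vector `ã`. -/
lemma strict_bounds (h : IsProperFace A F) (hdim : coneDim F + 2 ≤ n) {μ : ℝ} {y : Rn n}
    (hyW : y ∈ (Submodule.span ℝ F)ᗮ) (hyu : ⟪outerNormal A F, y⟫_ℝ = 0)
    (hy : ∀ a ∈ active A F, ⟪tildeNormal A F a, y⟫_ℝ < tildeRhs A F a + μ) {a : Rn n}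
    (ha : a ∈ active A F) :
    ⟪tildeNormal A F a, y⟫_ℝ < supportFn (basePolytope A F μ) (tildeNormal A F a) ∧
    -⟪tildeNormal A F a, y⟫_ℝ < supportFn (basePolytope A F μ) (-tildeNormal A F a) := by
  have hne := h.tilde_ne_zero hdim ha
  refine ⟨h.lt_supportFn hdim hyW hyu hy (h.tilde_mem_orthogonal ha)
    (h.inner_outerNormal_tilde a) hne, ?_⟩
  rw [← inner_neg_left]
  refine h.lt_supportFn hdim hyW hyu hy (Submodule.neg_mem _ (h.tilde_mem_orthogonal ha))
    ?_ (neg_ne_zero.2 hne)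
  rw [inner_neg_right, h.inner_outerNormal_tilde a, neg_zero]

lemma width_pos (h : IsProperFace A F) (hdim : coneDim F + 2 ≤ n) {μ : ℝ} (hμ : 0 < μ)
    {a : Rn n} (ha : a ∈ active A F) :
    0 < supportFn (basePolytope A F μ) (tildeNormal A F a) +
      supportFn (basePolytope A F μ) (-tildeNormal A F a) := by
  obtain ⟨y, hyW, hyu, hy⟩ := h.exists_strict hdim hμ
  have := h.strict_bounds hdim hyW hyu hy ha
  linarith

lemma basePolytope_nonempty (h : IsProperFace A F) (hdim : coneDim F + 2 ≤ n) {μ : ℝ}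
    (hμ : 0 < μ) : (basePolytope A F μ).Nonempty := by
  obtain ⟨y, hyW, hyu, hy⟩ := h.exists_strict hdim hμ
  exact ⟨y, hyW, hyu, fun a ha => (hy a ha).le⟩

lemma diam_pos (h : IsProperFace A F) (hdim : coneDim F + 2 ≤ n) {μ : ℝ} (hμ : 0 < μ) :
    0 < Metric.diam (basePolytope A F μ) := by
  obtain ⟨a, ha⟩ := h.active_nonempty
  exact (h.width_pos hdim hμ ha).trans_le
    (h.supportFn_add_le_diam hdim (h.basePolytope_nonempty hdim hμ) (h.norm_tilde hdim ha))

/-! ### Sign of the approximating polynomial of a face -/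

lemma one_le_codim (h : IsProperFace A F) : (1 : ℝ) ≤ (n : ℝ) - coneDim F := by
  have : ((coneDim F + 1 : ℕ) : ℝ) ≤ n := by exact_mod_cast h.dim_lt
  push_cast at this
  linarith

/-- An admissible exponent is positive, and `m < (1 + 2μ / ((n - dim F) diam P_μ))^(2q)`. -/
lemma card_lt_pow (h : IsProperFace A F) (hdim : coneDim F + 2 ≤ n) {ε : ℝ} (h0 : 0 < ε)
    (h1 : ε ≤ 1 / 2) {q : ℕ} (hq : exponentBound A F ε < q) :
    0 < q ∧ ((active A F).card : ℝ) < (1 + 2 * relax A F ε / (((n : ℝ) - coneDim F) *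
      Metric.diam (basePolytope A F (relax A F ε)))) ^ (2 * q) := by
  have hμ := h.relax_pos hdim h0 h1
  have hd : 0 < 2 * relax A F ε / (((n : ℝ) - coneDim F) *
      Metric.diam (basePolytope A F (relax A F ε))) :=
    div_pos (by linarith) (mul_pos (zero_lt_one.trans_le h.one_le_codim) (h.diam_pos hdim hμ))
  rw [exponentBound] at hq
  set d := 2 * relax A F ε / (((n : ℝ) - coneDim F) *
      Metric.diam (basePolytope A F (relax A F ε)))
  have hm : (1 : ℝ) ≤ (active A F).card := by
    exact_mod_cast Finset.card_pos.2 h.active_nonempty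
  have hlog : 0 < Real.log (1 + d) := Real.log_pos (by linarith)
  constructor
  · have : (0 : ℝ) ≤ Real.log ((active A F).card : ℝ) / (2 * Real.log (1 + d)) :=
      div_nonneg (Real.log_nonneg hm) (by linarith)
    exact_mod_cast this.trans_lt hq
  · rw [div_lt_iff₀ (by linarith)] at hq
    rw [← Real.log_lt_log_iff (by linarith) (by positivity), Real.log_pow]
    push_cast
    linarith

lemma eval_homogPoly_eq_zero (h : IsProperFace A F) (hdim : coneDim F + 2 ≤ n) {ε : ℝ} {q : ℕ}
    (hq : 0 < q) {x : Rn n} (hx : ∀ a ∈ active A F, ⟪a, x⟫_ℝ = 0) :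
    MvPolynomial.eval (fun j => x j) (homogPoly A F ε q) = 0 := by
  have hu := h.inner_outerNormal_eq_zero hx
  have ht : ∀ a ∈ active A F, ⟪tildeNormal A F a, x⟫_ℝ = 0 := fun a ha => by
    have h1 := h.projLen_mul_inner_tilde hdim ha x
    rw [hu, hx a ha, mul_zero, sub_zero] at h1
    exact (mul_eq_zero.1 h1).resolve_left (h.projLen_pos hdim ha).ne'
  rw [eval_homogPoly, hu, Finset.sum_eq_zero fun a ha => by rw [ht a ha]; simp [hq.ne']]
  simp [hq.ne']

/-- The polynomial is positive on a neighbourhood of the cone. -/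
lemma eval_homogPoly_pos (h : IsProperFace A F) (hdim : coneDim F + 2 ≤ n) {ε : ℝ} (h0 : 0 < ε)
    (h1 : ε ≤ 1 / 2) {q : ℕ} (hq : 0 < q) {x : Rn n} (hs : 0 < -⟪outerNormal A F, x⟫_ℝ)
    (hx : ∀ a ∈ active A F, ⟪a, x⟫_ℝ < ε * -⟪outerNormal A F, x⟫_ℝ) :
    0 < MvPolynomial.eval (fun j => x j) (homogPoly A F ε q) := by
  obtain ⟨y, hyW, hyu, hy⟩ := h.exists_section hdim hs
  rw [eval_homogPoly]
  set s : ℝ := -⟪outerNormal A F, x⟫_ℝ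
  have hystrict : ∀ a ∈ active A F,
      ⟪tildeNormal A F a, y⟫_ℝ < tildeRhs A F a + relax A F ε := by
    intro a ha
    have h2 := hx a ha
    have h3 := mul_le_mul_of_nonneg_right (h.le_relax_mul hdim h0 h1 ha) hs.le
    rw [(hy a ha).2] at h2
    have h4 : s * projLen A F a * (⟪tildeNormal A F a, y⟫_ℝ - tildeRhs A F a) <
        s * projLen A F a * relax A F ε := by linarith
    linarith [lt_of_mul_lt_mul_left h4 (mul_pos hs (h.projLen_pos hdim ha)).le]
  have hm : (0 : ℝ) < (active A F).card := by exact_mod_cast Finset.card_pos.2 h.active_nonempty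
  rw [sub_pos, one_div, inv_mul_lt_iff₀ hm, ← nsmul_eq_mul]
  refine (Finset.sum_lt_sum_of_nonempty h.active_nonempty fun a ha => ?_).trans_eq
    (Finset.sum_const _)
  obtain ⟨hb1, hb2⟩ := h.strict_bounds hdim hyW hyu hystrict ha
  rw [(hy a ha).1]
  set P := supportFn (basePolytope A F (relax A F ε)) (tildeNormal A F a)
  set N := supportFn (basePolytope A F (relax A F ε)) (-tildeNormal A F a)
  set r := ⟪tildeNormal A F a, y⟫_ℝ
  have hw : 0 < P + N := by linarith
  -- After homogenisation each term is `s` times the affine function of `r` that maps the slab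
  -- between the two supporting hyperplanes onto `[-1, 1]`.
  have he : 2 / (P + N) * (s * r) - (P - N) / (P + N) * s = s * ((2 * r - (P - N)) / (P + N)) := by
    ring
  have hlt : |(2 * r - (P - N)) / (P + N)| < 1 := by
    rw [abs_lt, lt_div_iff₀ hw, div_lt_one hw]
    constructor <;> linarith
  rw [he, mul_pow]
  refine mul_lt_of_lt_one_right (pow_pos hs _) ?_
  rw [pow_mul, ← sq_abs, ← pow_mul]
  exact pow_lt_one₀ (abs_nonneg _) hlt (by omega)

/-- The polynomial is nonnegative on the cone. -/
lemma eval_homogPoly_nonneg (h : IsProperFace A F) (hdim : coneDim F + 2 ≤ n) {ε : ℝ}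
    (h0 : 0 < ε) (h1 : ε ≤ 1 / 2) {q : ℕ} (hq : 0 < q) {x : Rn n} (hx : x ∈ coneOf A) :
    0 ≤ MvPolynomial.eval (fun j => x j) (homogPoly A F ε q) := by
  have hx' : ∀ a ∈ active A F, ⟪a, x⟫_ℝ ≤ 0 := fun a ha => hx a (active_subset A F ha)
  rcases (h.inner_outerNormal_nonpos hx').lt_or_eq with hlt | heq
  · exact (h.eval_homogPoly_pos hdim h0 h1 hq (neg_pos.2 hlt) fun a ha =>
      (hx' a ha).trans_lt (mul_pos h0 (neg_pos.2 hlt))).le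
  · exact (h.eval_homogPoly_eq_zero hdim hq (h.inner_eq_zero_of_nonpos hx' heq)).ge

/-- The polynomial is negative outside a neighbourhood of the cone. -/
lemma inner_le_of_eval_homogPoly_nonneg (h : IsProperFace A F) (hdim : coneDim F + 2 ≤ n) {ε : ℝ}
    (h0 : 0 < ε) (h1 : ε ≤ 1 / 2) {q : ℕ} (hq : exponentBound A F ε < q) {x : Rn n}
    (hs : 0 ≤ -⟪outerNormal A F, x⟫_ℝ)
    (hx : 0 ≤ MvPolynomial.eval (fun j => x j) (homogPoly A F ε q)) {a : Rn n}
    (ha : a ∈ active A F) :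
    ⟪a, x⟫_ℝ ≤ 4 * gammaConst A F * ε * -⟪outerNormal A F, x⟫_ℝ := by
  obtain ⟨hq0, hcard⟩ := h.card_lt_pow hdim h0 h1 hq
  have hμ := h.relax_pos hdim h0 h1
  have hw := fun b (hb : b ∈ active A F) => h.width_pos hdim hμ hb
  rw [eval_homogPoly] at hx
  have hm : (0 : ℝ) < (active A F).card := by exact_mod_cast Finset.card_pos.2 h.active_nonempty
  rw [sub_nonneg, one_div, inv_mul_le_iff₀ hm] at hx
  have hx' := (Finset.single_le_sum (fun b _ => (even_two_mul q).pow_nonneg _) ha).trans hx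
  have hwa := hw a ha
  have hdiam := h.supportFn_add_le_diam hdim (h.basePolytope_nonempty hdim hμ)
    (h.norm_tilde hdim ha)
  have hP : supportFn (basePolytope A F (relax A F ε)) (tildeNormal A F a) ≤
      tildeRhs A F a + relax A F ε := by
    refine csSup_le ((h.basePolytope_nonempty hdim hμ).image _) ?_
    rintro _ ⟨y, hy, rfl⟩
    exact hy.2.2 a ha
  have hl := h.projLen_pos hdim ha
  -- The codimension enters only through being at least `1`, which makes the admissible exponent
  -- large enough.
  have hcod := h.one_le_codim
  have hD := h.diam_pos hdim hμ
  have hle := h.relax_le hdim h0 h1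
  have hl1 := h.projLen_le_one ha
  clear hx
  rcases hs.lt_or_eq with hs | hs
  · obtain ⟨y, hyW, hyu, hy⟩ := h.exists_section hdim hs
    rw [(hy a ha).1] at hx'
    rw [(hy a ha).2]
    set s : ℝ := -⟪outerNormal A F, x⟫_ℝ
    set P := supportFn (basePolytope A F (relax A F ε)) (tildeNormal A F a)
    set N := supportFn (basePolytope A F (relax A F ε)) (-tildeNormal A F a)
    set D := Metric.diam (basePolytope A F (relax A F ε))
    set μ := relax A F ε
    set r := ⟪tildeNormal A F a, y⟫_ℝ
    set d := 2 * μ / (((n : ℝ) - coneDim F) * D) with hd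
    have hd0 : 0 < d := div_pos (by linarith) (mul_pos (by linarith) hD)
    have he : 2 / (P + N) * (s * r) - (P - N) / (P + N) * s =
        s * ((2 * r - (P - N)) / (P + N)) := by ring
    rw [he, mul_pow, mul_comm, mul_le_mul_iff_left₀ (pow_pos hs _)] at hx'
    -- One term of the sum is at most `m`, and `m < (1 + d)^(2q)` by admissibility, so the base is
    -- below `1 + d`.
    have hlt := lt_of_pow_lt_pow_left₀ _ (by linarith) (hx'.trans_lt hcard)
    rw [div_lt_iff₀ hwa] at hlt
    have hdD : d * (P + N) ≤ 2 * μ := by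
      calc d * (P + N) ≤ d * D := mul_le_mul_of_nonneg_left hdiam hd0.le
        _ = 2 * μ / ((n : ℝ) - coneDim F) := by
            rw [hd]
            field_simp
        _ ≤ 2 * μ := div_le_self (by linarith) hcod
    -- Unfolding the affine map gives `2 r < 2 P + d (P + N) ≤ 2 P + 2 μ`, and `P` is at most the
    -- relaxed right-hand side, so the excess is at most `2 μ`.
    have hr : r - tildeRhs A F a ≤ 2 * μ := by linarith
    calc s * projLen A F a * (r - tildeRhs A F a) ≤ s * projLen A F a * (2 * μ) :=
          mul_le_mul_of_nonneg_left hr (mul_pos hs hl).le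
      _ ≤ s * 1 * (2 * μ) := by gcongr
      _ ≤ 4 * gammaConst A F * ε * s := by nlinarith
  -- At height zero only minus a mean of even powers remains, so each power vanishes, and with it
  -- the constraint.
  · rw [← hs] at hx' ⊢
    rw [mul_zero, sub_zero, zero_pow (by omega), mul_zero] at hx'
    have h2 := pow_eq_zero_iff (by omega : 2 * q ≠ 0) |>.1
      (le_antisymm hx' ((even_two_mul q).pow_nonneg _))
    have h3 := (mul_eq_zero.1 h2).resolve_left (div_ne_zero two_ne_zero hwa.ne')
    have h4 := h.projLen_mul_inner_tilde hdim ha x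
    rw [h3, neg_eq_zero.1 hs.symm] at h4
    linarith

end IsProperFace

/-! ### Quantitative separation of two faces -/

/-- A system of homogeneous linear inequalities whose only solution in `W` is `0` has bounded
relaxations. -/
lemma exists_norm_le_of_inner_le (W : Submodule ℝ (Rn n)) (B : Finset (Rn n))
    (hB : ∀ x ∈ W, (∀ b ∈ B, ⟪b, x⟫_ℝ ≤ 0) → x = 0) :
    ∃ K : ℝ, 0 ≤ K ∧ ∀ x ∈ W, ∀ t : ℝ, 0 ≤ t → (∀ b ∈ B, ⟪b, x⟫_ℝ ≤ t) → ‖x‖ ≤ K * t := by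
  -- On the unit sphere of `W` the sum of the positive parts never vanishes, so by compactness it is
  -- bounded below by some `δ > 0`; homogeneity does the rest.
  have hcomp : IsCompact (Metric.sphere (0 : Rn n) 1 ∩ W) :=
    (isCompact_sphere 0 1).inter_right W.closed_of_finiteDimensional
  have hcont : ContinuousOn (fun x : Rn n => ∑ b ∈ B, max ⟪b, x⟫_ℝ 0)
      (Metric.sphere (0 : Rn n) 1 ∩ W) := by fun_prop
  obtain ⟨δ, hδ, hle⟩ := hcomp.exists_forall_le' hcont (a := 0) fun x hx => by
    refine (Finset.sum_pos_iff_of_nonneg fun b _ => le_max_right _ _).2 ?_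
    by_contra! hcon
    have hx0 := hB x hx.2 fun b hb => (le_max_left _ 0).trans (hcon b hb)
    have := mem_sphere_zero_iff_norm.1 hx.1
    rw [hx0, norm_zero] at this
    exact zero_ne_one this
  refine ⟨B.card / δ, by positivity, fun x hx t ht hxt => ?_⟩
  rcases eq_or_ne x 0 with rfl | hx0
  · rw [norm_zero]
    positivity
  · have hn : 0 < ‖x‖ := norm_pos_iff.2 hx0
    have h1 := hle (‖x‖⁻¹ • x) ⟨by
      rw [mem_sphere_zero_iff_norm, norm_smul, norm_inv, norm_norm, inv_mul_cancel₀ hn.ne'],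
      W.smul_mem _ hx⟩
    have h2 : ∑ b ∈ B, max ⟪b, ‖x‖⁻¹ • x⟫_ℝ 0 ≤ B.card • (‖x‖⁻¹ * t) := by
      refine Finset.sum_le_card_nsmul _ _ _ fun b hb => max_le ?_ (by positivity)
      rw [real_inner_smul_right]
      exact mul_le_mul_of_nonneg_left (hxt b hb) (inv_pos.2 hn).le
    have h3 := h1.trans h2
    rw [nsmul_eq_mul, inv_mul_eq_div, mul_div_assoc', le_div_iff₀ hn] at h3
    rw [div_mul_eq_mul_div, le_div_iff₀ hδ]
    linarith

/-- Near both `F` and `G` within the cone means near `F ∩ G`. -/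
lemma exists_bound_inter {A : Finset (Rn n)} {F G : Set (Rn n)} (hF : IsProperFace A F)
    (hG : IsProperFace A G) :
    ∃ K : ℝ, 0 ≤ K ∧ ∀ (x : Rn n) (t : ℝ), 0 ≤ t → (∀ a ∈ active A (F ∩ G), ⟪a, x⟫_ℝ ≤ t) →
      (∀ a ∈ active A F, -⟪a, x⟫_ℝ ≤ t) → (∀ a ∈ active A G, -⟪a, x⟫_ℝ ≤ t) →
      -⟪outerNormal A (F ∩ G), x⟫_ℝ ≤ K * t := by
  classical
  have hH : IsProperFace A (F ∩ G) :=
    { rep := hF.rep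
      interior := hF.interior
      nonempty := ⟨0, zero_mem_face hF.nonempty hF.exposed, zero_mem_face hG.nonempty hG.exposed⟩
      exposed := hF.exposed.inter hG.exposed
      dim_lt := (Submodule.finrank_mono (Submodule.span_mono Set.inter_subset_left)).trans_lt
        hF.dim_lt }
  set H := F ∩ G
  set W := (Submodule.span ℝ H)ᗮ
  set B := active A H ∪ (active A F ∪ active A G).image (fun a => -a)
  have hBle : ∀ (x : Rn n) (t : ℝ), (∀ b ∈ B, ⟪b, x⟫_ℝ ≤ t) ↔ (∀ a ∈ active A H, ⟪a, x⟫_ℝ ≤ t) ∧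
      (∀ a ∈ active A F, -⟪a, x⟫_ℝ ≤ t) ∧ (∀ a ∈ active A G, -⟪a, x⟫_ℝ ≤ t) := by
    intro x t
    simp only [B, Finset.mem_union, Finset.mem_image, or_imp, forall_and, exists_imp, and_imp]
    simp
  -- Such an `x` annihilates the normals of `F` and `G` and satisfies the constraints of `H`. Moving
  -- a relative interior point of `H` along `x` therefore stays in `F ∩ G`, so `x` lies in `lin(H)`
  -- as well as in its orthogonal complement.
  have hzero : ∀ x ∈ W, (∀ b ∈ B, ⟪b, x⟫_ℝ ≤ 0) → x = 0 := by
    intro x hxW hx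
    obtain ⟨hxH, hxF, hxG⟩ := (hBle x 0).1 hx
    have hxF0 : ∀ a ∈ active A F, ⟪a, x⟫_ℝ = 0 := fun a ha =>
      le_antisymm (hxH a (active_anti A Set.inter_subset_left ha)) (neg_nonpos.1 (hxF a ha))
    have hxG0 : ∀ a ∈ active A G, ⟪a, x⟫_ℝ = 0 := fun a ha =>
      le_antisymm (hxH a (active_anti A Set.inter_subset_right ha)) (neg_nonpos.1 (hxG a ha))
    obtain ⟨z, hzH, hz⟩ := exists_relint hH.nonempty hH.exposed
    obtain ⟨t, ht, hlt⟩ := exists_pos_smul_lt (A \ active A H) x (fun a => -⟪a, z⟫_ℝ)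
      fun a ha => by
        rw [Finset.mem_sdiff] at ha
        linarith [hz a ha.1 ha.2]
    have hC : z + t • x ∈ coneOf A := fun a ha => by
      rw [inner_add_right, real_inner_smul_right]
      by_cases h : a ∈ active A H
      · rw [(mem_active.1 h).2 z hzH]
        linarith [mul_nonpos_of_nonneg_of_nonpos ht.le (hxH a h)]
      · linarith [hlt a (Finset.mem_sdiff.2 ⟨ha, h⟩)]
    have hmemF : z + t • x ∈ F := by
      rw [face_eq hF.nonempty hF.exposed]
      refine ⟨hC, fun a ha => ?_⟩
      rw [inner_add_right, real_inner_smul_right, hxF0 a ha, (mem_active.1 ha).2 z hzH.1]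
      simp
    have hmemG : z + t • x ∈ G := by
      rw [face_eq hG.nonempty hG.exposed]
      refine ⟨hC, fun a ha => ?_⟩
      rw [inner_add_right, real_inner_smul_right, hxG0 a ha, (mem_active.1 ha).2 z hzH.2]
      simp
    have hxs : x ∈ Submodule.span ℝ H := by
      have h : x = t⁻¹ • ((z + t • x) - z) := by
        rw [add_sub_cancel_left, smul_smul, inv_mul_cancel₀ ht.ne', one_smul]
      rw [h]
      exact Submodule.smul_mem _ _ (Submodule.sub_mem _
        (Submodule.subset_span (show z + t • x ∈ H from ⟨hmemF, hmemG⟩))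
        (Submodule.subset_span hzH))
    exact inner_self_eq_zero (𝕜 := ℝ).1 (hxW x hxs)
  obtain ⟨K, hK0, hK⟩ := exists_norm_le_of_inner_le W B hzero
  refine ⟨K, hK0, fun x t ht h1 h2 h3 => ?_⟩
  have hproj : ∀ v ∈ W, ⟪v, W.starProjection x⟫_ℝ = ⟪v, x⟫_ℝ := fun v hv => by
    rw [← Submodule.inner_starProjection_left_eq_right,
      Submodule.starProjection_eq_self_iff.2 hv]
  have hact : ∀ a ∈ active A H, ⟪a, W.starProjection x⟫_ℝ = ⟪a, x⟫_ℝ := fun a ha =>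
    hproj a (hH.active_mem_orthogonal ha)
  have h4 := hK _ (Submodule.starProjection_apply_mem W x) t ht ((hBle _ t).2
    ⟨fun a ha => (hact a ha).trans_le (h1 a ha),
      fun a ha => by rw [hact a (active_anti A Set.inter_subset_left ha)]; exact h2 a ha,
      fun a ha => by rw [hact a (active_anti A Set.inter_subset_right ha)]; exact h3 a ha⟩)
  rw [← hproj _ hH.outerNormal_mem_orthogonal]
  refine le_trans ?_ h4
  have h5 := abs_real_inner_le_norm (outerNormal A H) (W.starProjection x)
  rw [hH.norm_outerNormal, one_mul] at h5
  exact (neg_le_abs _).trans h5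

/-- If `p_F` is small at a point that violates the constraints of `F` only slightly, then all
constraints of `F` are nearly active there. -/
lemma IsProperFace.neg_inner_le {A : Finset (Rn n)} {F : Set (Rn n)} (hF : IsProperFace A F)
    {x : Rn n} {t : ℝ} (ht : 0 ≤ t) (hx : ∀ a ∈ active A F, ⟪a, x⟫_ℝ ≤ t)
    (hp : -⟪outerNormal A F, x⟫_ℝ ≤ t) {a : Rn n} (ha : a ∈ active A F) :
    -⟪a, x⟫_ℝ ≤ 2 * A.card * t := by
  classical
  have h1 := hF.norm_mul_inner x
  rw [← Finset.add_sum_erase _ (fun b => ⟪b, x⟫_ℝ) ha] at h1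
  have h2 : ∑ b ∈ (active A F).erase a, ⟪b, x⟫_ℝ ≤ ((active A F).erase a).card • t :=
    Finset.sum_le_card_nsmul _ _ _ fun b hb => hx b (Finset.mem_of_mem_erase hb)
  have h3 : (((active A F).erase a).card : ℝ) ≤ A.card := by
    exact_mod_cast Finset.card_le_card ((Finset.erase_subset _ _).trans (active_subset A F))
  rw [nsmul_eq_mul] at h2
  have h4 := mul_le_mul_of_nonneg_right h3 ht
  have h5 : ‖∑ a ∈ active A F, a‖ * -⟪outerNormal A F, x⟫_ℝ ≤ A.card * t :=
    (mul_le_mul_of_nonneg_left hp (norm_nonneg _)).trans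
      (mul_le_mul_of_nonneg_right hF.norm_sum_le ht)
  linarith

/-- Two faces cannot both be bad at a point close to the cone, unless the point lies in the
lineality space of the face-cone of their intersection. -/
lemma inner_eq_zero_of_close {A : Finset (Rn n)} {F G : Set (Rn n)} (hF : IsProperFace A F)
    (hG : IsProperFace A G) (hH : IsProperFace A (F ∩ G)) {K τ : ℝ}
    (hK : ∀ (x : Rn n) (t : ℝ), 0 ≤ t → (∀ a ∈ active A (F ∩ G), ⟪a, x⟫_ℝ ≤ t) →
      (∀ a ∈ active A F, -⟪a, x⟫_ℝ ≤ t) → (∀ a ∈ active A G, -⟪a, x⟫_ℝ ≤ t) →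
      -⟪outerNormal A (F ∩ G), x⟫_ℝ ≤ K * t)
    (hτ : 0 ≤ τ) (hsmall : K * (2 * A.card * τ) < 1) {x : Rn n}
    (hs : 0 ≤ -⟪outerNormal A (F ∩ G), x⟫_ℝ)
    (hx : ∀ a ∈ active A (F ∩ G), ⟪a, x⟫_ℝ ≤ τ * -⟪outerNormal A (F ∩ G), x⟫_ℝ)
    (hxF : -⟪outerNormal A F, x⟫_ℝ ≤ τ * -⟪outerNormal A (F ∩ G), x⟫_ℝ)
    (hxG : -⟪outerNormal A G, x⟫_ℝ ≤ τ * -⟪outerNormal A (F ∩ G), x⟫_ℝ) :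
    ∀ a ∈ active A (F ∩ G), ⟪a, x⟫_ℝ = 0 := by
  have hsF := active_anti A (Set.inter_subset_left : F ∩ G ⊆ F)
  have hsG := active_anti A (Set.inter_subset_right : F ∩ G ⊆ G)
  have hcard : (1 : ℝ) ≤ A.card := by
    exact_mod_cast Finset.card_pos.2 (hF.active_nonempty.mono (active_subset A F))
  have ht := mul_nonneg hτ hs
  have h1 := hK x (2 * A.card * (τ * -⟪outerNormal A (F ∩ G), x⟫_ℝ)) (by positivity)
    (fun a ha => (hx a ha).trans (by nlinarith))
    (fun a ha => hF.neg_inner_le ht (fun b hb => hx b (hsF hb)) hxF ha)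
    (fun a ha => hG.neg_inner_le ht (fun b hb => hx b (hsG hb)) hxG ha)
  -- The bound reads `p_H ≤ K (2 |A| τ) p_H` with a factor below `1`, which leaves only `p_H = 0`.
  have h0 : -⟪outerNormal A (F ∩ G), x⟫_ℝ = 0 := by
    refine le_antisymm ?_ hs
    by_contra! hpos
    nlinarith [mul_lt_mul_of_pos_right hsmall hpos]
  rw [h0, mul_zero] at hx
  exact hH.inner_eq_zero_of_nonpos hx (neg_eq_zero.1 h0)

/-- Different facets that meet in a ridge are not both bad. -/
lemma ridge_contradiction {A : Finset (Rn n)} {F G : Set (Rn n)} (hF : IsProperFace A F)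
    (hG : IsProperFace A G) (hH : IsProperFace A (F ∩ G)) (hdF : coneDim F + 1 = n)
    (hdG : coneDim G + 1 = n) (hdH : coneDim (F ∩ G) + 2 = n) (hne : F ≠ G) {x : Rn n}
    (hs : 0 ≤ -⟪outerNormal A (F ∩ G), x⟫_ℝ) (hxF : -⟪outerNormal A F, x⟫_ℝ ≤ 0) :
    0 ≤ -⟪outerNormal A G, x⟫_ℝ := by
  classical
  have hcard : ∀ {E : Set (Rn n)}, IsProperFace A E → ∀ {d : ℕ}, coneDim E + d = n → d ≤ 2 →
      (active A E).card ≤ d := fun {E} hE {d} hd hd2 => by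
    have h1 := finrank_span_active hE.nonempty hE.exposed
    exact hE.rep.card_le_of_finrank hE.interior (active_subset A E) hd2 (by omega)
  obtain ⟨f, hf⟩ := Finset.card_eq_one.1
    (le_antisymm (hcard hF hdF (by norm_num)) (Finset.card_pos.2 hF.active_nonempty))
  obtain ⟨g, hg⟩ := Finset.card_eq_one.1
    (le_antisymm (hcard hG hdG (by norm_num)) (Finset.card_pos.2 hG.active_nonempty))
  have hfg : f ≠ g := fun h => hne (face_injOn hF.nonempty hF.exposed hG.nonempty hG.exposed
    (by rw [hf, hg, h]))
  have hsF := active_anti A (Set.inter_subset_left : F ∩ G ⊆ F)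
  have hsG := active_anti A (Set.inter_subset_right : F ∩ G ⊆ G)
  rw [hf, Finset.singleton_subset_iff] at hsF
  rw [hg, Finset.singleton_subset_iff] at hsG
  have hact : active A (F ∩ G) = {f, g} := by
    refine (Finset.eq_of_subset_of_card_le ?_ ?_).symm
    · rw [Finset.insert_subset_iff, Finset.singleton_subset_iff]
      exact ⟨hsF, hsG⟩
    · rw [Finset.card_pair hfg]
      exact hcard hH hdH le_rfl
  have h1 := hF.norm_mul_inner x
  have h2 := hG.norm_mul_inner x
  have h3 := hH.norm_mul_inner x
  have p1 := hF.norm_sum_pos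
  have p2 := hG.norm_sum_pos
  have p3 := hH.norm_sum_pos
  rw [hf, Finset.sum_singleton] at h1 p1
  rw [hg, Finset.sum_singleton] at h2 p2
  rw [hact, Finset.sum_pair hfg, Finset.sum_pair hfg] at h3
  rw [hact, Finset.sum_pair hfg] at p3
  -- With `f` and `g` the only active normals, `‖f + g‖ p_H = ‖f‖ p_F + ‖g‖ p_G`; the right-hand
  -- side would be negative.
  by_contra! hcon
  rw [Finset.sum_singleton] at h1 h2
  nlinarith [mul_nonneg p1.le (neg_nonpos.1 hxF), mul_pos p2 (neg_lt_zero.1 hcon),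
    mul_nonneg p3.le hs]

/-! ### From products to factors: induction over the dimension of faces -/

lemma eval_prodFace (A : Finset (Rn n)) (k : ℕ) (x : Rn n) :
    MvPolynomial.eval (fun j => x j) (prodFace A (coneOf A) k) =
      ∏ F ∈ (finite_faces A k).toFinset, -⟪outerNormal A F, x⟫_ℝ := by
  rw [prodFace, finprod_mem_eq_finite_toFinset_prod _ (finite_faces A k), map_prod]
  exact Finset.prod_congr rfl fun F _ => eval_facePoly A F x

lemma eval_prodApprox (A : Finset (Rn n)) (ε : ℕ → ℝ) (q : Set (Rn n) → ℕ) {k : ℕ}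
    (hk : k + 3 ≤ n) (x : Rn n) :
    MvPolynomial.eval (fun j => x j) (prodApprox A (coneOf A) ε q k) =
      ∏ F ∈ (finite_faces A k).toFinset,
        MvPolynomial.eval (fun j => x j) (homogPoly A F (ε k) (q F)) := by
  rw [prodApprox, finprod_mem_eq_finite_toFinset_prod _ (finite_faces A k), map_prod]
  refine Finset.prod_congr rfl fun F hF => ?_
  have hd : coneDim F = k := ((finite_faces A k).mem_toFinset.1 hF).2.2
  rw [approxPoly, if_neg (by omega)]

lemma prodFace_eq_prodApprox (A : Finset (Rn n)) (C : Set (Rn n)) (ε : ℕ → ℝ)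
    (q : Set (Rn n) → ℕ) {k : ℕ} (hk : n ≤ k + 2) : prodFace A C k = prodApprox A C ε q k := by
  refine finprod_mem_congr rfl fun F hF => ?_
  rw [approxPoly, if_pos (by rw [hF.2.2]; exact hk)]

lemma mem_semialgSet_conePolys {A : Finset (Rn n)} {C : Set (Rn n)} {ε : ℕ → ℝ}
    {q : Set (Rn n) → ℕ} {x : Rn n} (hn : 2 ≤ n) : x ∈ semialgSet (conePolys A C ε q) ↔
      (∀ k < n, 0 ≤ MvPolynomial.eval (fun j => x j) (prodFace A C k)) ∧
      ∀ k, k + 3 ≤ n → 0 ≤ MvPolynomial.eval (fun j => x j) (prodApprox A C ε q k) := by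
  constructor
  · intro h
    refine ⟨fun k hk => ?_, fun k hk => ?_⟩
    · have := h ⟨k, by omega⟩
      rwa [conePolys, if_pos hk] at this
    -- The index `n + k` is below `2 * n - 2` exactly when `k + 3 ≤ n`.
    · have := h ⟨n + k, by omega⟩
      rwa [conePolys, if_neg (by simp), Nat.add_sub_cancel_left] at this
  · rintro ⟨h1, h2⟩ ⟨i, hi⟩
    rw [conePolys]
    split_ifs with hin
    · exact h1 i hin
    · exact h2 _ (by simp only at hin ⊢; omega)

lemma prod_neg_of_neg_of_pos {ι : Type*} {s : Finset ι} {f : ι → ℝ} {i : ι} (hi : i ∈ s)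
    (hneg : f i < 0) (hpos : ∀ j ∈ s, j ≠ i → 0 < f j) : ∏ j ∈ s, f j < 0 := by
  classical
  rw [← Finset.mul_prod_erase s f hi]
  exact mul_neg_of_neg_of_pos hneg (Finset.prod_pos fun j hj =>
    hpos j (Finset.mem_of_mem_erase hj) (Finset.ne_of_mem_erase hj))

/-- Constants that work for all faces simultaneously. -/
lemma exists_uniform_constants (A : Finset (Rn n)) :
    ∃ Γ K : ℝ, 0 < Γ ∧ 0 < K ∧ (∀ F, IsProperFace A F → 4 * gammaConst A F ≤ Γ) ∧
      ∀ F G, IsProperFace A F → IsProperFace A G → ∀ (x : Rn n) (t : ℝ), 0 ≤ t →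
        (∀ a ∈ active A (F ∩ G), ⟪a, x⟫_ℝ ≤ t) → (∀ a ∈ active A F, -⟪a, x⟫_ℝ ≤ t) →
        (∀ a ∈ active A G, -⟪a, x⟫_ℝ ≤ t) → -⟪outerNormal A (F ∩ G), x⟫_ℝ ≤ K * t := by
  have hfin := finite_exposed A
  obtain ⟨Γ, hΓ⟩ := (hfin.image fun F => 4 * gammaConst A F).bddAbove
  have hex : ∀ F G, ∃ K : ℝ, IsProperFace A F → IsProperFace A G → ∀ (x : Rn n) (t : ℝ), 0 ≤ t →
      (∀ a ∈ active A (F ∩ G), ⟪a, x⟫_ℝ ≤ t) → (∀ a ∈ active A F, -⟪a, x⟫_ℝ ≤ t) →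
      (∀ a ∈ active A G, -⟪a, x⟫_ℝ ≤ t) → -⟪outerNormal A (F ∩ G), x⟫_ℝ ≤ K * t := by
    intro F G
    by_cases hFG : IsProperFace A F ∧ IsProperFace A G
    · obtain ⟨K, -, hK⟩ := exists_bound_inter hFG.1 hFG.2
      exact ⟨K, fun _ _ => hK⟩
    · exact ⟨0, fun hF hG => absurd ⟨hF, hG⟩ hFG⟩
  choose K hK using hex
  obtain ⟨K', hK'⟩ := ((hfin.prod hfin).image fun p => K p.1 p.2).bddAbove
  refine ⟨max Γ 1, max K' 1, by positivity, by positivity, fun F hF => ?_,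
    fun F G hF hG x t ht h1 h2 h3 => ?_⟩
  · exact (hΓ ⟨F, ⟨hF.nonempty, hF.exposed⟩, rfl⟩).trans (le_max_left _ _)
  · refine (hK F G hF hG x t ht h1 h2 h3).trans (mul_le_mul_of_nonneg_right ?_ ht)
    exact (hK' ⟨(F, G), ⟨⟨hF.nonempty, hF.exposed⟩, ⟨hG.nonempty, hG.exposed⟩⟩, rfl⟩).trans
      (le_max_left _ _)

/-- If all products are nonnegative at `x`, then so are all their factors. -/
lemma factors_nonneg {A : Finset (Rn n)} (h : IsNonredundantRep A (coneOf A))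
    (hint : ∃ z : Rn n, ∀ a ∈ A, ⟪a, z⟫_ℝ < 0) {Γ K c : ℝ} (hΓ : 0 < Γ)
    (hγ : ∀ F, IsProperFace A F → 4 * gammaConst A F ≤ Γ)
    (hK : ∀ F G, IsProperFace A F → IsProperFace A G → ∀ (x : Rn n) (t : ℝ), 0 ≤ t →
        (∀ a ∈ active A (F ∩ G), ⟪a, x⟫_ℝ ≤ t) → (∀ a ∈ active A F, -⟪a, x⟫_ℝ ≤ t) →
        (∀ a ∈ active A G, -⟪a, x⟫_ℝ ≤ t) → -⟪outerNormal A (F ∩ G), x⟫_ℝ ≤ K * t)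
    (hc0 : 0 < c) (hc : c ≤ 1 / 2) (hsmall : K * (2 * A.card * (Γ * c)) < 1)
    {ε : ℕ → ℝ} {q : Set (Rn n) → ℕ} (hε : ∀ k, k + 3 ≤ n → 0 < ε k ∧ ε k ≤ c)
    (hεε : ∀ k l, k < l → l + 3 ≤ n → ε k ≤ c * ε l)
    (hq : ∀ k, k + 3 ≤ n → ∀ F ∈ faces (coneOf A) k, exponentBound A F (ε k) < (q F : ℝ))
    {x : Rn n}
    (hx1 : ∀ k < n, 0 ≤ MvPolynomial.eval (fun j => x j) (prodFace A (coneOf A) k))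
    (hx2 : ∀ k, k + 3 ≤ n →
      0 ≤ MvPolynomial.eval (fun j => x j) (prodApprox A (coneOf A) ε q k)) (k : ℕ) (hk : k < n) :
    ∀ F ∈ faces (coneOf A) k, 0 ≤ -⟪outerNormal A F, x⟫_ℝ ∧
      (k + 3 ≤ n → 0 ≤ MvPolynomial.eval (fun j => x j) (homogPoly A F (ε k) (q F))) := by
  have proper : ∀ {j : ℕ}, j < n → ∀ {F}, F ∈ faces (coneOf A) j → IsProperFace A F :=
    fun hj _ hF => ⟨h, hint, hF.1, hF.2.1, hF.2.2.trans_lt hj⟩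
  induction k using Nat.strong_induction_on with
  | _ k ih =>
  have hq0 : k + 3 ≤ n → ∀ F ∈ faces (coneOf A) k, 0 < q F := fun hk3 F hF =>
    ((proper hk hF).card_lt_pow (by rw [hF.2.2]; omega) (hε k hk3).1 ((hε k hk3).2.trans hc)
      (hq k hk3 F hF)).1
  -- The conditions are asymmetric: `G` has a negative factor, but the other face may only have a
  -- zero one, since products are merely nonnegative. The two factors may also be of different
  -- types.
  have hsep : ∀ G ∈ faces (coneOf A) k, ∀ F ∈ faces (coneOf A) k, F ≠ G →
      (-⟪outerNormal A G, x⟫_ℝ < 0 ∨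
        (k + 3 ≤ n ∧ MvPolynomial.eval (fun j => x j) (homogPoly A G (ε k) (q G)) < 0)) →
      ¬ (-⟪outerNormal A F, x⟫_ℝ ≤ 0 ∨
        (k + 3 ≤ n ∧ MvPolynomial.eval (fun j => x j) (homogPoly A F (ε k) (q F)) ≤ 0)) := by
    intro G hG F hF hne hGbad hFbad
    obtain ⟨j, hjk, hH⟩ := inter_mem_faces hF hG hne
    have pF := proper hk hF
    have pG := proper hk hG
    have pH := proper (hjk.trans hk) hH
    obtain ⟨hs, hs'⟩ := ih j hjk (hjk.trans hk) _ hH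
    by_cases hj3 : j + 3 ≤ n
    · obtain ⟨hεj, hεjc⟩ := hε j hj3
      have hclose : ∀ a ∈ active A (F ∩ G),
          ⟪a, x⟫_ℝ ≤ Γ * ε j * -⟪outerNormal A (F ∩ G), x⟫_ℝ := fun a ha => by
        refine (pH.inner_le_of_eval_homogPoly_nonneg (by rw [hH.2.2]; omega) hεj (hεjc.trans hc)
          (hq j hj3 _ hH) hs (hs' hj3) ha).trans ?_
        exact mul_le_mul_of_nonneg_right (mul_le_mul_of_nonneg_right (hγ _ pH) hεj.le) hs
      -- If `p_E` exceeded `Γ c p_H`, then closeness to the face-cone of `H` together with `ε_j ≤ c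
      -- ε_k` would place `x` where the polynomial of `E` is positive.
      have hbad : ∀ E ∈ faces (coneOf A) k, active A E ⊆ active A (F ∩ G) →
          (-⟪outerNormal A E, x⟫_ℝ ≤ 0 ∨
          (k + 3 ≤ n ∧ MvPolynomial.eval (fun j => x j) (homogPoly A E (ε k) (q E)) ≤ 0)) →
          -⟪outerNormal A E, x⟫_ℝ ≤ Γ * c * -⟪outerNormal A (F ∩ G), x⟫_ℝ := by
        intro E hE hsub hEbad
        by_cases hE0 : -⟪outerNormal A E, x⟫_ℝ ≤ 0
        · exact hE0.trans (mul_nonneg (mul_pos hΓ hc0).le hs)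
        · obtain ⟨hk3, hEv⟩ := hEbad.resolve_left hE0
          obtain ⟨hεk, hεkc⟩ := hε k hk3
          by_contra! hcon
          refine absurd hEv (not_le.2 ((proper hk hE).eval_homogPoly_pos (by rw [hE.2.2]; omega)
            hεk (hεkc.trans hc) (hq0 hk3 E hE) (not_le.1 hE0) fun a ha => ?_))
          calc ⟪a, x⟫_ℝ ≤ Γ * ε j * -⟪outerNormal A (F ∩ G), x⟫_ℝ := hclose a (hsub ha)
            _ ≤ Γ * (c * ε k) * -⟪outerNormal A (F ∩ G), x⟫_ℝ :=
                mul_le_mul_of_nonneg_right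
                  (mul_le_mul_of_nonneg_left (hεε j k hjk hk3) hΓ.le) hs
            _ = ε k * (Γ * c * -⟪outerNormal A (F ∩ G), x⟫_ℝ) := by ring
            _ < ε k * -⟪outerNormal A E, x⟫_ℝ := mul_lt_mul_of_pos_left hcon hεk
      have hz := inner_eq_zero_of_close pF pG pH (hK F G pF pG) (mul_pos hΓ hc0).le hsmall hs
        (fun a ha => (hclose a ha).trans
          (mul_le_mul_of_nonneg_right (mul_le_mul_of_nonneg_left hεjc hΓ.le) hs))
        (hbad F hF (active_anti A Set.inter_subset_left) hFbad)
        (hbad G hG (active_anti A Set.inter_subset_right)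
          (hGbad.imp le_of_lt fun h => ⟨h.1, h.2.le⟩))
      have hzG : ∀ a ∈ active A G, ⟪a, x⟫_ℝ = 0 := fun a ha =>
        hz a (active_anti A Set.inter_subset_right ha)
      rcases hGbad with hlt | ⟨hk3, hlt⟩
      · rw [pG.inner_outerNormal_eq_zero hzG, neg_zero] at hlt
        exact lt_irrefl _ hlt
      · rw [pG.eval_homogPoly_eq_zero (by rw [hG.2.2]; omega) (hq0 hk3 G hG) hzG] at hlt
        exact lt_irrefl _ hlt
    -- Here `j = n - 2` and `k = n - 1`, so only the linear factors exist.
    · have hlt := hGbad.resolve_right fun h => by omega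
      have hle := hFbad.resolve_right fun h => by omega
      exact absurd (ridge_contradiction pF pG pH (by rw [hF.2.2]; omega) (by rw [hG.2.2]; omega)
        (by rw [hH.2.2]; omega) hne hs hle) (not_le.2 hlt)
  intro G hG
  have hGmem : G ∈ (finite_faces A k).toFinset := (finite_faces A k).mem_toFinset.2 hG
  constructor
  · by_contra! hlt
    have h1 := hx1 k hk
    rw [eval_prodFace] at h1
    refine absurd h1 (not_le.2 (prod_neg_of_neg_of_pos hGmem hlt fun F hF hne => ?_))
    by_contra! hle
    exact hsep G hG F ((finite_faces A k).mem_toFinset.1 hF) hne (Or.inl hlt) (Or.inl hle)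
  · intro hk3
    by_contra! hlt
    have h1 := hx2 k hk3
    rw [eval_prodApprox A ε q hk3] at h1
    refine absurd h1 (not_le.2 (prod_neg_of_neg_of_pos hGmem hlt fun F hF hne => ?_))
    by_contra! hle
    exact hsep G hG F ((finite_faces A k).mem_toFinset.1 hF) hne (Or.inr ⟨hk3, hlt⟩)
      (Or.inr ⟨hk3, hle⟩)

end ConePoly

end

/-! ### Choice of the constant and the two inclusions -/

theorem theorem1p1 (n : ℕ) (hn : 2 ≤ n) (C : Set (ConePoly.Rn n))
    (hC : ConePoly.IsPolyhedralCone C) (hpointed : ConePoly.IsPointed C)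
    (hdim : ConePoly.coneDim C = n) :
    (∃ A : Finset (ConePoly.Rn n), ConePoly.IsNonredundantRep A C) ∧
    ∀ A : Finset (ConePoly.Rn n), ConePoly.IsNonredundantRep A C →
      ∃ c : ℝ, 0 < c ∧ c ≤ 1 / 2 ∧
        ∀ (ε : ℕ → ℝ) (q : Set (ConePoly.Rn n) → ℕ),
          (∀ k, k + 3 ≤ n → 0 < ε k ∧ ε k ≤ c) →
          (∀ k l, k < l → l + 3 ≤ n → ε k ≤ c * ε l) →
          (∀ k, k + 3 ≤ n → ∀ F ∈ ConePoly.faces C k,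
            ConePoly.exponentBound A F (ε k) < (q F : ℝ)) →
          ConePoly.prodFace A C (n - 1) = ConePoly.prodApprox A C ε q (n - 1) ∧
          ConePoly.prodFace A C (n - 2) = ConePoly.prodApprox A C ε q (n - 2) ∧
          C = ConePoly.semialgSet (ConePoly.conePolys A C ε q) := by
  open ConePoly in
  refine ⟨hC.exists_nonredundantRep, fun A hA => ?_⟩
  have hCA := hA.eq_coneOf
  subst hCA
  have hint := exists_interior hA.norm_eq_one hdim
  obtain ⟨Γ, K, hΓ, hK0, hγ, hK⟩ := exists_uniform_constants A
  -- The constant `c` must make `K (2 |A| Γ c)` less than `1`; using `|A| + 1` yields strict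
  -- inequality and a nonzero denominator.
  have hpos : 0 < K * (2 * (A.card + 1) * Γ) := by positivity
  refine ⟨min (1 / 2) (1 / (K * (2 * (A.card + 1) * Γ))),
    lt_min (by norm_num) (one_div_pos.2 hpos), min_le_left _ _, fun ε q hε hεε hq => ?_⟩
  set c := min (1 / 2) (1 / (K * (2 * (A.card + 1) * Γ)))
  have hc0 : 0 < c := lt_min (by norm_num) (one_div_pos.2 hpos)
  have hc : c ≤ 1 / 2 := min_le_left _ _
  have hsmall : K * (2 * A.card * (Γ * c)) < 1 := by
    have h1 : c * (K * (2 * (A.card + 1) * Γ)) ≤ 1 := by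
      rw [← le_div_iff₀ hpos]
      exact min_le_right _ _
    have h2 : 0 < K * (Γ * c) := by positivity
    nlinarith
  refine ⟨prodFace_eq_prodApprox A _ ε q (by omega), prodFace_eq_prodApprox A _ ε q (by omega), ?_⟩
  have proper : ∀ {j : ℕ}, j < n → ∀ {F}, F ∈ faces (coneOf A) j → IsProperFace A F :=
    fun hj _ hF => ⟨hA, hint, hF.1, hF.2.1, hF.2.2.trans_lt hj⟩
  ext x
  rw [mem_semialgSet_conePolys hn]
  constructor
  · intro hx
    refine ⟨fun k hk => ?_, fun k hk => ?_⟩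
    · rw [eval_prodFace]
      refine Finset.prod_nonneg fun F hF => neg_nonneg.2 ?_
      exact (proper hk ((finite_faces A k).mem_toFinset.1 hF)).inner_outerNormal_nonpos
        fun a ha => hx a (active_subset A F ha)
    · rw [eval_prodApprox A ε q hk]
      refine Finset.prod_nonneg fun F hF => ?_
      have hF' := (finite_faces A k).mem_toFinset.1 hF
      have pF := proper (by omega) hF'
      have hd : coneDim F + 2 ≤ n := by rw [hF'.2.2]; omega
      have hεk := hε k hk
      exact pF.eval_homogPoly_nonneg hd hεk.1 (hεk.2.trans hc)
        (pF.card_lt_pow hd hεk.1 (hεk.2.trans hc) (hq k hk F hF')).1 hx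
  · rintro ⟨hx1, hx2⟩ a ha
    -- The facet whose only active normal is `a` turns nonnegativity of its linear factor into the
    -- constraint of `a`.
    obtain ⟨F, hF, hact⟩ := hA.exists_facet hint ha
    have pF := proper (by omega) hF
    have h1 := (factors_nonneg hA hint hΓ hγ hK hc0 hc hsmall hε hεε hq hx1 hx2 (n - 1)
      (by omega) F hF).1
    have h2 := pF.norm_mul_inner x
    rw [hact, Finset.sum_singleton, Finset.sum_singleton] at h2
    rw [← h2]
    exact mul_nonpos_of_nonneg_of_nonpos (norm_nonneg _) (by linarith)
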